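/- Let $\mathfrak g$ be a finite-dimensional complex semisimple Lie algebra with Cartan subalgebra $\mathfrak h$ and a Borel subalgebra $\mathfrak b=\mathfrak h\oplus\mathfrak n_+$, and let $h_1,\dots,h_r\in\mathfrak h$ be the simple coroots. Let $A$ be a commutative $\mathbb C$-algebra with unit, and let $M$ be the set of ideals of $A$ of codimension one, that is, of $\mathbb C$-algebra homomorphisms $A\to\mathbb C$, $P\mapsto P(\mathcal Z)$ (if $A$ is the algebra of functions on an affine variety, $M$ is the set of its points). A $\mathfrak g\otimes A$-module $V$ is called $\mathfrak g\otimes 1$-integrable if there is a finite subset $D$ of the weight lattice with $V=\bigoplus_{\mu\in D}V^\mu$, where $V^\mu=\{x\in V:(h\otimes 1)x=\mu(h)x \text{ for all } h\in\mathfrak h\}$. Its weight spaces may be infinite-dimensional. For $\lambda\in\mathfrak h^*$, the global Weyl module $W_A(\lambda)$ is the maximal $\mathfrak g\otimes 1$-integrable $\mathfrak g\otimes A$-module generated by a vector $v_\lambda$ with $(\mathfrak n_+\otimes P)v_\lambda=0$ and $(h\otimes 1)v_\lambda=\lambda(h)v_\lambda$ for all $P\in A$, $h\in\mathfrak h$.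 A $\lambda$-multiset $\{\mathcal Z\}_\lambda$ consists, for each $i=1,\dots,r$, of $\lambda(h_i)$ points $\mathcal Z^{(i)}_1,\dots,\mathcal Z^{(i)}_{\lambda(h_i)}$ of $M$, not necessarily distinct (in particular the numbers $\lambda(h_i)$ are non-negative integers). The local Weyl module $W_M(\{\mathcal Z\}_\lambda)$ is the maximal $\mathfrak g\otimes 1$-integrable $\mathfrak g\otimes A$-module generated by a vector $v$ with $(\mathfrak n_+\otimes P)v=0$ and $(h_i\otimes P)v=\sum_{j=1}^{\lambda(h_i)}P(\mathcal Z^{(i)}_j)\,v$ for all $P\in A$, $i=1,\dots,r$. Here a module is maximal if every other module of the same kind is a quotient of it, with generator mapping to generator. **Theorem.** Every quotient $W$ of the $\mathfrak g\otimes A$-module $W_A(\lambda)$ with $\dim W^\lambda=1$ is a quotient of the local Weyl module $W_M(\{\mathcal Z\}_\lambda)$ for some $\lambda$-multiset $\{\mathcal Z\}_\lambda$. -/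

import Mathlib

open scoped TensorProduct

noncomputable section

namespace WeylModules

universe u v w

/-! ### Modules over the current algebra

The Lie algebra of currents `𝔤 ⊗ A` is written `A ⊗[ℂ] 𝔤`, with bracket
`⁅P ⊗ x, Q ⊗ y⁆ = (P * Q) ⊗ ⁅x, y⁆`. -/

section Modules

variable {𝔤 : Type u} [LieRing 𝔤] [LieAlgebra ℂ 𝔤]

/-- The weight space `V^μ` of a `𝔤 ⊗ A`-module `V`: the vectors on which every `h ⊗ 1`, `h ∈ 𝔥`,
acts by the scalar `μ(h)`. -/
def weightSpace (𝔥 : LieSubalgebra ℂ 𝔤) (A : Type v) [CommRing A] [Algebra ℂ A]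
    (V : Type w) [AddCommGroup V] [Module ℂ V] [LieRingModule (A ⊗[ℂ] 𝔤) V]
    [LieModule ℂ (A ⊗[ℂ] 𝔤) V] (μ : Module.Dual ℂ 𝔥) : Submodule ℂ V where
  carrier := {x | ∀ h : 𝔥, ⁅(1 : A) ⊗ₜ[ℂ] (h : 𝔤), x⁆ = μ h • x}
  add_mem' := by
    intro x y hx hy h
    rw [lie_add, hx h, hy h, smul_add]
  zero_mem' := by
    intro h
    rw [lie_zero, smul_zero]
  smul_mem' := by
    intro c x hx h
    rw [lie_smul, hx h, smul_comm]

variable (𝔤) in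
/-- The universal enveloping algebra `U(𝔤 ⊗ A)`. -/
abbrev CurrentEnv (A : Type v) [CommRing A] [Algebra ℂ A] : Type _ :=
  UniversalEnvelopingAlgebra ℂ (A ⊗[ℂ] 𝔤)

/-- The element `x ⊗ P` of `U(𝔤 ⊗ A)`. -/
def cur {A : Type v} [CommRing A] [Algebra ℂ A] (x : 𝔤) (P : A) : CurrentEnv 𝔤 A :=
  UniversalEnvelopingAlgebra.ι ℂ (P ⊗ₜ[ℂ] x)

/-- The cyclic `𝔤 ⊗ A`-module `U(𝔤 ⊗ A) / N` attached to a left ideal `N`. -/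
def CyclicModule {A : Type v} [CommRing A] [Algebra ℂ A]
    (N : Submodule (CurrentEnv 𝔤 A) (CurrentEnv 𝔤 A)) : Type _ :=
  CurrentEnv 𝔤 A ⧸ N

namespace CyclicModule

variable {A : Type v} [CommRing A] [Algebra ℂ A]
  (N : Submodule (CurrentEnv 𝔤 A) (CurrentEnv 𝔤 A))

instance instAddCommGroup : AddCommGroup (CyclicModule N) :=
  inferInstanceAs (AddCommGroup (CurrentEnv 𝔤 A ⧸ N))

instance instModuleEnv : Module (CurrentEnv 𝔤 A) (CyclicModule N) :=
  inferInstanceAs (Module (CurrentEnv 𝔤 A) (CurrentEnv 𝔤 A ⧸ N))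

instance instModule : Module ℂ (CyclicModule N) :=
  inferInstanceAs (Module ℂ (CurrentEnv 𝔤 A ⧸ N))

instance instIsScalarTower : IsScalarTower ℂ (CurrentEnv 𝔤 A) (CyclicModule N) :=
  inferInstanceAs (IsScalarTower ℂ (CurrentEnv 𝔤 A) (CurrentEnv 𝔤 A ⧸ N))

/-- `𝔤 ⊗ A` acts by left multiplication. -/
instance instLieRingModule : LieRingModule (A ⊗[ℂ] 𝔤) (CyclicModule N) where
  bracket x m := UniversalEnvelopingAlgebra.ι ℂ x • m
  add_lie x y m := by
    change UniversalEnvelopingAlgebra.ι ℂ (x + y) • m = _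
    rw [map_add, add_smul]
  lie_add x m n := smul_add _ _ _
  leibniz_lie x y m := by
    let _ : LieRing (CurrentEnv 𝔤 A) := LieRing.ofAssociativeRing
    change UniversalEnvelopingAlgebra.ι ℂ x • UniversalEnvelopingAlgebra.ι ℂ y • m =
      UniversalEnvelopingAlgebra.ι ℂ ⁅x, y⁆ • m +
        UniversalEnvelopingAlgebra.ι ℂ y • UniversalEnvelopingAlgebra.ι ℂ x • m
    rw [LieHom.map_lie, LieRing.of_associative_ring_bracket, sub_smul, mul_smul, mul_smul,
      sub_add_cancel]

instance instLieModule : LieModule ℂ (A ⊗[ℂ] 𝔤) (CyclicModule N) where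
  smul_lie c x m := by
    change UniversalEnvelopingAlgebra.ι ℂ (c • x) • m = c • UniversalEnvelopingAlgebra.ι ℂ x • m
    rw [map_smul, smul_assoc]
  lie_smul c x m := by
    change UniversalEnvelopingAlgebra.ι ℂ x • c • m = c • UniversalEnvelopingAlgebra.ι ℂ x • m
    rw [← algebraMap_smul (CurrentEnv 𝔤 A) c m, ← mul_smul, ← Algebra.commutes, mul_smul,
      algebraMap_smul]

end CyclicModule

end Modules

/-! ### Weyl modules

`𝔤` is semisimple with Cartan subalgebra `𝔥`; the Borel subalgebra is given by a base `b` of the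
root system. The simple roots are indexed by `i : b.support`, and
`h_i = (LieAlgebra.IsKilling.rootSystem 𝔥).coroot i`. -/

section Weyl

variable {𝔤 : Type u} [LieRing 𝔤] [LieAlgebra ℂ 𝔤] [FiniteDimensional ℂ 𝔤]
  [LieAlgebra.IsSemisimple ℂ 𝔤] {𝔥 : LieSubalgebra ℂ 𝔤} [𝔥.IsCartanSubalgebra]

/-- The Chevalley generator `h_i`, that is the simple coroot. -/
def simpleCoroot (b : (LieAlgebra.IsKilling.rootSystem 𝔥).Base) (i : b.support) : 𝔥 :=
  (LieAlgebra.IsKilling.rootSystem 𝔥).coroot i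

/-- The weight lattice `P`: the weights taking integer values on all `h_i`. -/
def weightLattice (b : (LieAlgebra.IsKilling.rootSystem 𝔥).Base) : Set (Module.Dual ℂ 𝔥) :=
  {μ | ∀ i : b.support, ∃ k : ℤ, μ (simpleCoroot b i) = k}

/-- A `𝔤 ⊗ A`-module is `𝔤 ⊗ 1`-integrable if it is the direct sum of its weight spaces over a
finite set `D` of weights in the weight lattice (which need not be finite-dimensional). -/
def IsIntegrable (b : (LieAlgebra.IsKilling.rootSystem 𝔥).Base)
    (A : Type v) [CommRing A] [Algebra ℂ A]
    (V : Type w) [AddCommGroup V] [Module ℂ V] [LieRingModule (A ⊗[ℂ] 𝔤) V]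
    [LieModule ℂ (A ⊗[ℂ] 𝔤) V] : Prop :=
  ∃ D : Finset (Module.Dual ℂ 𝔥), (D : Set (Module.Dual ℂ 𝔥)) ⊆ weightLattice b ∧
    iSupIndep (fun μ : D => weightSpace 𝔥 A V μ.1) ∧
    ⨆ μ : D, weightSpace 𝔥 A V μ.1 = ⊤

/-- The nilradical `𝔫₊` of the Borel subalgebra, as a subspace: the sum of the root spaces of the
positive roots. -/
def nPlus (b : (LieAlgebra.IsKilling.rootSystem 𝔥).Base) : Submodule ℂ 𝔤 :=
  ⨆ α : {α : 𝔥.root // b.IsPos α},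
    (LieAlgebra.rootSpace 𝔥 (α.1.1 : 𝔥 → ℂ)).toSubmodule

/-- For a left ideal `J`, the left ideal `N` such that `U(𝔤 ⊗ A) / N` is the maximal
`𝔤 ⊗ 1`-integrable quotient of `U(𝔤 ⊗ A) / J`: the smallest left ideal through whose quotient all
integrable quotients of `U(𝔤 ⊗ A) / J` factor. -/
def integrableIdeal (b : (LieAlgebra.IsKilling.rootSystem 𝔥).Base)
    {A : Type v} [CommRing A] [Algebra ℂ A]
    (J : Submodule (CurrentEnv 𝔤 A) (CurrentEnv 𝔤 A)) :
    Submodule (CurrentEnv 𝔤 A) (CurrentEnv 𝔤 A) :=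
  sInf {N | J ≤ N ∧ IsIntegrable b A (CyclicModule N)}

/-- The left ideal generated by `𝔫₊ ⊗ A` and all `h ⊗ 1 - lam(h)`, `h ∈ 𝔥`; the quotient by it is
the module induced from the character of `𝔫₊ ⊗ A ⊕ 𝔥 ⊗ 1` given by `lam`. -/
def globalIdeal (A : Type v) [CommRing A] [Algebra ℂ A]
    (b : (LieAlgebra.IsKilling.rootSystem 𝔥).Base) (lam : Module.Dual ℂ 𝔥) :
    Submodule (CurrentEnv 𝔤 A) (CurrentEnv 𝔤 A) :=
  Submodule.span (CurrentEnv 𝔤 A)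
    ({y | ∃ x ∈ nPlus b, ∃ P : A, y = cur x P} ∪
      {y | ∃ h : 𝔥, y = cur (h : 𝔤) (1 : A) - algebraMap ℂ (CurrentEnv 𝔤 A) (lam h)})

/-- The global Weyl module `W_A(lam)`: the maximal `𝔤 ⊗ 1`-integrable module generated by a vector
`v` with `(𝔫₊ ⊗ P) v = 0` and `(h ⊗ 1) v = lam(h) v`. -/
abbrev GlobalWeylModule (A : Type v) [CommRing A] [Algebra ℂ A]
    (b : (LieAlgebra.IsKilling.rootSystem 𝔥).Base) (lam : Module.Dual ℂ 𝔥) : Type _ :=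
  CyclicModule (integrableIdeal b (globalIdeal A b lam))

/-- A `lam`-multiset: for each simple root `i`, a multiset of `lam(h_i)` points of
`M = Spec A`. A point (an ideal of codimension one) is given by its evaluation homomorphism
`A → ℂ`. Such an object exists only if all `lam(h_i)` are non-negative integers. -/
structure LambdaMultiset (A : Type v) [CommRing A] [Algebra ℂ A]
    (b : (LieAlgebra.IsKilling.rootSystem 𝔥).Base) (lam : Module.Dual ℂ 𝔥) where
  points : b.support → Multiset (A →ₐ[ℂ] ℂ)
  card_points : ∀ i, ((points i).card : ℂ) = lam (simpleCoroot b i)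

/-- The left ideal generated by `𝔫₊ ⊗ A` and all `h_i ⊗ P - ∑ⱼ P(Z⁽ⁱ⁾ⱼ)`; the quotient by it is
the module induced from the corresponding character of `𝔟 ⊗ A`. -/
def localIdeal {A : Type v} [CommRing A] [Algebra ℂ A]
    {b : (LieAlgebra.IsKilling.rootSystem 𝔥).Base} {lam : Module.Dual ℂ 𝔥}
    (Z : LambdaMultiset A b lam) :
    Submodule (CurrentEnv 𝔤 A) (CurrentEnv 𝔤 A) :=
  Submodule.span (CurrentEnv 𝔤 A)
    ({y | ∃ x ∈ nPlus b, ∃ P : A, y = cur x P} ∪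
      {y | ∃ (i : b.support) (P : A), y = cur (simpleCoroot b i : 𝔤) P -
        algebraMap ℂ (CurrentEnv 𝔤 A) ((Z.points i).map fun z => z P).sum})

/-- The local Weyl module `W_M(Z)`: the maximal `𝔤 ⊗ 1`-integrable module generated by a vector
`v` with `(𝔫₊ ⊗ P) v = 0` and `(h_i ⊗ P) v = (∑ⱼ P(Z⁽ⁱ⁾ⱼ)) v`. -/
abbrev LocalWeylModule {A : Type v} [CommRing A] [Algebra ℂ A]
    {b : (LieAlgebra.IsKilling.rootSystem 𝔥).Base} {lam : Module.Dual ℂ 𝔥}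
    (Z : LambdaMultiset A b lam) : Type _ :=
  CyclicModule (integrableIdeal b (localIdeal Z))

end Weyl

end WeylModules

end

/-! Let `v` be the image of the generator. Since the weight space of `lam` is a line, `h_i ⊗ P` acts
on `v` by a scalar χ(P), and the point is that χ is a sum of n = lam(h_i) homomorphisms A → ℂ. Given
such points for every i, `v` satisfies the relations of a local Weyl module and generates W.

Fix i and write E, F, H for the operators of the corresponding 𝔰𝔩₂ ⊗ A, and w = F(1)ⁿ v ≠ 0. Every
product F(P₁)⋯F(Pₙ) v is a lowest weight vector for 𝔰𝔩₂ ⊗ 1. Its image under E(1)ⁿ lies in ℂv, and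
F(1)ⁿ E(1)ⁿ acts on it by a nonzero scalar, so it equals ψ(P₁,…,Pₙ) w. Applying H(Q), which acts on
w by -χ(Q), yields χ(Q) ψ(P) = ∑ⱼ ψ(…, Q Pⱼ, …) (`exists_points_of_slTwo`).

So, as a functional on A^{⊗n}, ψ is an eigenvector of multiplication by each power sum ∑ⱼ Q⁽ʲ⁾, and
the subalgebra S they generate acquires a character. By Newton's identities A^{⊗n} is integral over
S, so the character extends to A^{⊗n}; its restrictions to the n tensor factors are the points
(`exists_eq_sum_algHom`). No finiteness of A is needed.

Integrability of W requires an argument, because the maximal integrable quotient is defined by an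
intersection of left ideals. A uniform bound resolves this: every weight of an integrable module of
highest weight `lam` is at most as long as `lam` in the root form (`IsHighestWeight.rootForm_le`),
and only finitely many lattice weights are (`finite_rootForm_le`). -/

noncomputable section

namespace WeylModules

set_option linter.unusedSectionVars false

/-! ### Power sums, integrality and extension of complex points -/

section PowerSums

variable {T : Type*} [CommRing T] [Algebra ℂ T]

/-- A subalgebra in characteristic zero containing all power sums of a family contains its
elementary symmetric functions. -/
lemma aeval_esymm_mem {σ : Type*} [Fintype σ] (S : Subalgebra ℂ T) (x : σ → T)
    (h : ∀ m, ∑ i, x i ^ m ∈ S) (k : ℕ) :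
    MvPolynomial.aeval x (MvPolynomial.esymm σ ℂ k) ∈ S := by
  classical
  induction k using Nat.strong_induction_on with
  | _ k ih =>
    rcases Nat.eq_zero_or_pos k with rfl | hk
    · simp
    have key := congrArg (MvPolynomial.aeval x) (MvPolynomial.mul_esymm_eq_sum σ ℂ k)
    have hmem : (k : ℂ) • MvPolynomial.aeval x (MvPolynomial.esymm σ ℂ k) ∈ S := by
      have : (k : ℂ) • MvPolynomial.aeval x (MvPolynomial.esymm σ ℂ k) =
          MvPolynomial.aeval x ((k : MvPolynomial σ ℂ) * MvPolynomial.esymm σ ℂ k) := by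
        simp [Algebra.smul_def]
      rw [this, key, map_mul, map_sum]
      refine S.mul_mem ?_ (S.sum_mem fun a ha => ?_)
      · simpa using S.pow_mem (S.neg_mem S.one_mem) _
      · rw [map_mul, map_mul]
        refine S.mul_mem (S.mul_mem ?_ (ih _ (by simpa using (Finset.mem_filter.1 ha).2))) ?_
        · simpa using S.pow_mem (S.neg_mem S.one_mem) _
        · simpa [MvPolynomial.psum] using h a.2
    have := S.smul_mem hmem ((k : ℂ)⁻¹)
    rwa [smul_smul, inv_mul_cancel₀ (by exact_mod_cast hk.ne'), one_smul] at this

/-- The members of a finite family are integral over any subalgebra containing all its power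
sums. -/
lemma isIntegral_of_power_sums_mem {σ : Type*} [Fintype σ] (S : Subalgebra ℂ T) (x : σ → T)
    (h : ∀ m, ∑ i, x i ^ m ∈ S) (i : σ) : IsIntegral S (x i) := by
  classical
  nontriviality T
  set s : Multiset T := Finset.univ.val.map x
  set p : Polynomial T := (s.map fun t => Polynomial.X - Polynomial.C t).prod with hp
  have hmonic : p.Monic := Polynomial.monic_multiset_prod_of_monic _ _
    fun t _ => Polynomial.monic_X_sub_C t
  have hlift : p ∈ Polynomial.lifts (algebraMap S T) := by
    rw [Polynomial.lifts_iff_coeff_lifts]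
    intro k
    have : p.coeff k ∈ S := by
      by_cases hk : k ≤ Multiset.card s
      · rw [hp, Multiset.prod_X_sub_C_coeff s hk]
        refine S.mul_mem (S.pow_mem (S.neg_mem S.one_mem) _) ?_
        have := aeval_esymm_mem S x h (Multiset.card s - k)
        rwa [MvPolynomial.aeval_esymm_eq_multiset_esymm] at this
      · rw [Polynomial.coeff_eq_zero_of_natDegree_lt]
        · exact S.zero_mem
        · rw [hp, Polynomial.natDegree_multiset_prod_X_sub_C_eq_card]
          omega
    exact ⟨⟨_, this⟩, rfl⟩
  obtain ⟨q, hq, -, hqm⟩ := Polynomial.lifts_and_natDegree_eq_and_monic hlift hmonic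
  refine ⟨q, hqm, ?_⟩
  rw [Polynomial.eval₂_eq_eval_map, hq, hp, Polynomial.eval_multiset_prod]
  refine Multiset.prod_eq_zero (Multiset.mem_map.2 ⟨Polynomial.X - Polynomial.C (x i), ?_, by simp⟩)
  exact Multiset.mem_map.2 ⟨x i, Multiset.mem_map.2 ⟨i, Finset.mem_univ _, rfl⟩, rfl⟩

/-- Complex points extend along integral extensions. -/
lemma exists_algHom_extending (S : Subalgebra ℂ T) [Algebra.IsIntegral S T] (c : S →ₐ[ℂ] ℂ) :
    ∃ φ : T →ₐ[ℂ] ℂ, ∀ s : S, φ s = c s := by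
  have hc : Function.Surjective c := fun z => ⟨algebraMap ℂ S z, by simp⟩
  have hmax : (RingHom.ker c).IsMaximal := RingHom.ker_isMaximal_of_surjective c hc
  obtain ⟨Q, hQ, hQc⟩ := Ideal.exists_ideal_over_maximal_of_isIntegral (S := T) (RingHom.ker c)
    (by
      intro s hs
      have : s = 0 := Subtype.ext (by simpa using hs)
      simp [this])
  let _ : Field (T ⧸ Q) := Ideal.Quotient.field Q
  -- S acts on T/Q through c, so a monic equation over S becomes one over ℂ. Hence T/Q is integral
  -- over ℂ and equal to it.
  have hcompat : ∀ s : S, Ideal.Quotient.mk Q (s : T) = algebraMap ℂ (T ⧸ Q) (c s) := by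
    intro s
    have : s - algebraMap ℂ S (c s) ∈ RingHom.ker c := by simp [RingHom.mem_ker]
    rw [← hQc, Ideal.mem_comap] at this
    have h2 := Ideal.Quotient.eq_zero_iff_mem.2 this
    rw [map_sub, map_sub, sub_eq_zero] at h2
    exact h2
  have hint : Algebra.IsIntegral ℂ (T ⧸ Q) := by
    refine ⟨fun y => ?_⟩
    obtain ⟨t, rfl⟩ := Ideal.Quotient.mk_surjective y
    obtain ⟨p, hp, hpt⟩ := Algebra.IsIntegral.isIntegral (R := S) t
    refine ⟨p.map c.toRingHom, hp.map _, ?_⟩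
    have h2 := congrArg (Ideal.Quotient.mk Q) hpt
    rw [Polynomial.hom_eval₂, map_zero] at h2
    rw [Polynomial.eval₂_map, ← h2]
    congr 1
    ext s
    exact (hcompat s).symm
  have hbij := IsAlgClosed.algebraMap_bijective_of_isIntegral (k := ℂ) (K := T ⧸ Q)
  let e : ℂ ≃ₐ[ℂ] (T ⧸ Q) := AlgEquiv.ofBijective (Algebra.ofId ℂ (T ⧸ Q)) hbij
  refine ⟨(e.symm : (T ⧸ Q) →ₐ[ℂ] ℂ).comp (Ideal.Quotient.mkₐ ℂ Q), fun s => ?_⟩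
  change e.symm (Ideal.Quotient.mk Q (s : T)) = c s
  rw [hcompat s, AlgEquiv.symm_apply_eq]
  rfl

end PowerSums

/-- A functional `χ` whose values are the eigenvalues of the power sums `∑ⱼ Q⁽ʲ⁾` on a nonzero
functional on `A^{⊗ n}` is a sum of `n` points. -/
lemma exists_eq_sum_algHom {A : Type*} [CommRing A] [Algebra ℂ A] {n : ℕ}
    (ψ : MultilinearMap ℂ (fun _ : Fin n => A) ℂ) (χ : A → ℂ) (h1 : ψ (fun _ => 1) ≠ 0)
    (h : ∀ Q P, χ Q * ψ P = ∑ j, ψ (Function.update P j (Q * P j))) :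
    ∃ z : Fin n → (A →ₐ[ℂ] ℂ), ∀ Q, χ Q = ∑ j, z j Q := by
  classical
  let Ψ : (⨂[ℂ] _ : Fin n, A) →ₗ[ℂ] ℂ := PiTensorProduct.lift ψ
  let ins : Fin n → A →ₐ[ℂ] (⨂[ℂ] _ : Fin n, A) :=
    fun j => PiTensorProduct.singleAlgHom (R := ℂ) (A := fun _ => A) j
  have hins : ∀ j Q, ins j Q = PiTensorProduct.tprod ℂ (Pi.mulSingle j Q) := fun j Q => rfl
  let p : A → (⨂[ℂ] _ : Fin n, A) := fun Q => ∑ j, ins j Q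
  have hp : ∀ Q t, Ψ (p Q * t) = χ Q * Ψ t := by
    intro Q t
    induction t using PiTensorProduct.induction_on with
    | smul_tprod r P =>
      simp only [p, Finset.sum_mul, mul_smul_comm, map_smul, map_sum, hins,
        PiTensorProduct.tprod_mul_tprod]
      simp only [Ψ, PiTensorProduct.lift.tprod, smul_eq_mul]
      rw [h]
      refine congrArg _ (Finset.sum_congr rfl fun j _ => congrArg _ ?_)
      funext i
      by_cases hij : i = j
      · subst hij; simp
      · simp [hij]
    | add x y hx hy => rw [mul_add, map_add, hx, hy, map_add, mul_add]
  let S : Subalgebra ℂ (⨂[ℂ] _ : Fin n, A) := Algebra.adjoin ℂ (Set.range p)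
  have hS : ∀ s ∈ S, ∃ r : ℂ, ∀ t, Ψ (s * t) = r * Ψ t := by
    intro s hs
    induction hs using Algebra.adjoin_induction with
    | mem s hs => obtain ⟨Q, rfl⟩ := hs; exact ⟨χ Q, hp Q⟩
    | algebraMap r => exact ⟨r, fun t => by rw [← Algebra.smul_def, map_smul, smul_eq_mul]⟩
    | add x y _ _ hx hy =>
      obtain ⟨a, ha⟩ := hx
      obtain ⟨b, hb⟩ := hy
      exact ⟨a + b, fun t => by rw [add_mul, map_add, ha, hb, add_mul]⟩
    | mul x y _ _ hx hy =>
      obtain ⟨a, ha⟩ := hx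
      obtain ⟨b, hb⟩ := hy
      exact ⟨a * b, fun t => by rw [mul_assoc, ha, hb, mul_assoc]⟩
  have hΨ1 : Ψ 1 ≠ 0 := by
    rw [PiTensorProduct.one_def]
    simp only [Ψ, PiTensorProduct.lift.tprod]
    exact h1
  -- The eigenvalue of s is recovered as Ψ(s)/Ψ(1); it is multiplicative because Ψ is a common
  -- eigenvector.
  let c : S →ₐ[ℂ] ℂ := AlgHom.ofLinearMap ((Ψ 1)⁻¹ • Ψ ∘ₗ S.val.toLinearMap)
    (by simp [hΨ1])
    (by
      rintro ⟨x, hx⟩ ⟨y, hy⟩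
      obtain ⟨a, ha⟩ := hS x hx
      have hx1 := ha 1
      rw [mul_one] at hx1
      change (Ψ 1)⁻¹ * Ψ (x * y) = ((Ψ 1)⁻¹ * Ψ x) * ((Ψ 1)⁻¹ * Ψ y)
      rw [ha, hx1]
      field_simp)
  -- The m-th power sum of the elements Q⁽ʲ⁾ is p(Qᵐ), again a generator of S.
  have hinsint : ∀ j Q, IsIntegral S (ins j Q) := fun j Q =>
    isIntegral_of_power_sums_mem S (fun j => ins j Q)
      (fun m => Algebra.subset_adjoin ⟨Q ^ m, by simp [p]⟩) j
  have : Algebra.IsIntegral S (⨂[ℂ] _ : Fin n, A) := by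
    refine ⟨fun t => ?_⟩
    induction t using PiTensorProduct.induction_on with
    | smul_tprod r P =>
      have : r • PiTensorProduct.tprod ℂ P =
          algebraMap S _ (algebraMap ℂ S r) * ∏ j, ins j (P j) := by
        simp only [hins, ← PiTensorProduct.tprod_prod]
        rw [Algebra.smul_def]
        congr 2
        funext i
        simp [Finset.prod_apply, Pi.mulSingle_apply]
      rw [this]
      exact isIntegral_algebraMap.mul (IsIntegral.prod _ fun j _ => hinsint j (P j))
    | add x y hx hy => exact hx.add hy
  obtain ⟨φ, hφ⟩ := exists_algHom_extending S c
  refine ⟨fun j => φ.comp (ins j), fun Q => ?_⟩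
  have h2 := hφ ⟨p Q, Algebra.subset_adjoin ⟨Q, rfl⟩⟩
  have h3 : c ⟨p Q, Algebra.subset_adjoin ⟨Q, rfl⟩⟩ = χ Q := by
    change (Ψ 1)⁻¹ * Ψ (p Q) = χ Q
    have := hp Q 1
    rw [mul_one] at this
    rw [this]
    field_simp
  rw [← h3, ← h2]
  simp [p]

/-! ### Operator calculus for 𝔰𝔩₂ and its currents -/

section SlTwo

variable {V : Type*} [AddCommGroup V] [Module ℂ V]

section Single

variable {E F H : Module.End ℂ V} (hEF : ∀ x, E (F x) = F (E x) + H x)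
  (hHF : ∀ x, H (F x) = F (H x) - (2 : ℂ) • F x) {m : V} {c : ℂ} (hE : E m = 0) (hH : H m = c • m)

include hHF hH in
lemma cartan_pow_lower (n : ℕ) : H ((F ^ n) m) = (c - 2 * n) • (F ^ n) m := by
  induction n with
  | zero => simpa using hH
  | succ n ih =>
    rw [pow_succ', Module.End.mul_apply, hHF, ih, map_smul, ← sub_smul]
    congr 1
    push_cast
    ring

include hEF hHF hE hH in
lemma raise_pow_lower (n : ℕ) :
    E ((F ^ (n + 1)) m) = ((n + 1) * (c - n) : ℂ) • (F ^ n) m := by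
  induction n with
  | zero => simp [hEF, hE, hH]
  | succ n ih =>
    rw [pow_succ', Module.End.mul_apply, hEF, ih, map_smul, cartan_pow_lower hHF hH,
      ← Module.End.mul_apply, ← pow_succ', ← add_smul]
    congr 1
    push_cast
    ring

-- The scalar is a product of factors (j + 1)(n - j) with j < k, none of which vanishes while k ≤ n.
include hEF hHF hE hH in
lemma exists_raise_pow_lower_pow {n : ℕ} (hc : c = n) {k : ℕ} (hk : k ≤ n) :
    ∃ a : ℂ, a ≠ 0 ∧ (E ^ k) ((F ^ k) m) = a • m := by
  induction k with
  | zero => exact ⟨1, one_ne_zero, by simp⟩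
  | succ k ih =>
    obtain ⟨a, ha, h⟩ := ih (by omega)
    refine ⟨(k + 1) * (c - k) * a, mul_ne_zero (mul_ne_zero ?_ ?_) ha, ?_⟩
    · exact_mod_cast k.succ_ne_zero
    · rw [hc, sub_ne_zero]
      exact_mod_cast (by omega : n ≠ k)
    · rw [pow_succ, Module.End.mul_apply, raise_pow_lower hEF hHF hE hH, map_smul, h, smul_smul]

end Single

section Loop

variable {A : Type*} [CommRing A] [Algebra ℂ A] {E F H : A →ₗ[ℂ] Module.End ℂ V}
  (hEF : ∀ P Q x, E P (F Q x) = F Q (E P x) + H (P * Q) x)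
  (hHF : ∀ P Q x, H P (F Q x) = F Q (H P x) - (2 : ℂ) • F (P * Q) x)
  (hHE : ∀ x, H 1 (E 1 x) = E 1 (H 1 x) + (2 : ℂ) • E 1 x)
  (hFF : ∀ P Q x, F P (F Q x) = F Q (F P x))
  {v : V} {χ : A → ℂ} (hE : ∀ P, E P v = 0) (hH : ∀ P, H P v = χ P • v)

include hHF hH in
lemma cartan_prod_lower (Q : A) {n : ℕ} (P : Fin n → A) :
    H Q ((List.ofFn fun j => F (P j)).prod v) = χ Q • (List.ofFn fun j => F (P j)).prod v -
      (2 : ℂ) • ∑ j, (List.ofFn fun k => F (Function.update P j (Q * P j) k)).prod v := by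
  induction n with
  | zero => simp [hH]
  | succ n ih =>
    simp only [List.ofFn_succ, List.prod_cons, Module.End.mul_apply, Fin.sum_univ_succ]
    rw [hHF, ih (fun j => P j.succ)]
    have h0 : ∀ k : Fin n, Function.update P 0 (Q * P 0) k.succ = P k.succ := fun k => by simp
    have h1 : ∀ j k : Fin n, Function.update P j.succ (Q * P j.succ) k.succ =
        Function.update (fun i : Fin n => P i.succ) j (Q * P j.succ) k := fun j k => by
      by_cases hjk : k = j
      · subst hjk; simp
      · simp [hjk]
    have h2 : ∀ j : Fin n, Function.update P j.succ (Q * P j.succ) 0 = P 0 := fun j => by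
      rw [Function.update_of_ne (Fin.succ_ne_zero j).symm]
    simp only [h0, h1, h2, Function.update_self, map_sub, map_smul, map_sum, smul_add]
    abel

include hHF hFF hH in
lemma cartan_pow_lower_one (Q : A) (k : ℕ) : H Q ((F 1 ^ (k + 1)) v) =
    χ Q • (F 1 ^ (k + 1)) v - (2 * (k + 1) : ℂ) • F Q ((F 1 ^ k) v) := by
  have hp : ∀ j, F 1 ((F 1 ^ j) v) = (F 1 ^ (j + 1)) v := fun j => by
    rw [pow_succ', Module.End.mul_apply]
  induction k with
  | zero => simp [hHF, hH]
  | succ k ih =>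
    rw [← hp, hHF, ih, map_sub, map_smul, map_smul, mul_one, hFF 1 Q, hp, hp]
    push_cast
    module

-- Moving E(Q) past one F(1) creates H(Q); moving H(Q) on creates F(Q), which `cartan_pow_lower_one`
-- eliminates. At k = n, where F(1)ⁿ⁺¹ v = 0, this determines H(Q) on the lowest vector as -χ(Q).
include hEF hHF hFF hE hH in
lemma raise_pow_lower_one (Q : A) (k : ℕ) : (2 : ℂ) • E Q ((F 1 ^ (k + 1)) v) =
    (k + 1 : ℂ) • (χ Q • (F 1 ^ k) v + H Q ((F 1 ^ k) v)) := by
  induction k with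
  | zero => simp [hEF, hE, hH, two_smul]
  | succ k ih =>
    have h := cartan_pow_lower_one hHF hFF hH Q k
    rw [pow_succ', Module.End.mul_apply, hEF, mul_one, smul_add, ← map_smul, ih, map_smul, map_add,
      map_smul]
    have h3 : F 1 (H Q ((F 1 ^ k) v)) = H Q ((F 1 ^ (k + 1)) v) + (2 : ℂ) • F Q ((F 1 ^ k) v) := by
      rw [pow_succ', Module.End.mul_apply, hHF, mul_one, sub_add_cancel]
    rw [h3, ← Module.End.mul_apply (F 1), ← pow_succ', h]
    push_cast
    module

include hEF hHF hHE hFF hE hH in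
/-- The eigenvalues of `h ⊗ A` on the top weight line of a module over the currents of `𝔰𝔩₂` are
given by a sum of `n` points. -/
lemma exists_points_of_slTwo {n : ℕ} (hv : v ≠ 0) (hn : χ 1 = n)
    (hlow : ∀ P : Fin n → A, F 1 ((List.ofFn fun j => F (P j)).prod v) = 0)
    (htop : ∀ P : Fin n → A, ∃ c : ℂ, (E 1 ^ n) ((List.ofFn fun j => F (P j)).prod v) = c • v) :
    ∃ z : Fin n → (A →ₐ[ℂ] ℂ), ∀ Q, χ Q = ∑ j, z j Q := by
  have hEF1 : ∀ x, E 1 (F 1 x) = F 1 (E 1 x) + H 1 x := fun x => by rw [hEF, mul_one]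
  have hHF1 : ∀ x, H 1 (F 1 x) = F 1 (H 1 x) - (2 : ℂ) • F 1 x := fun x => by rw [hHF, mul_one]
  have hone : (List.ofFn fun _ : Fin n => F (1 : A)).prod = F 1 ^ n := by
    rw [List.ofFn_const, List.prod_replicate]
  set w := (F 1 ^ n) v with hw
  have hw0 : w ≠ 0 := by
    obtain ⟨a, ha, h⟩ := exists_raise_pow_lower_pow hEF1 hHF1 (hE 1) (hH 1) hn le_rfl
    intro h0
    rw [← hw, h0, map_zero, eq_comm, smul_eq_zero] at h
    exact h.elim ha hv
  have hHw : ∀ Q, H Q w = -(χ Q • w) := by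
    intro Q
    have h := raise_pow_lower_one hEF hHF hFF hE hH Q n
    have h0 : (F 1 ^ (n + 1)) v = 0 := by
      rw [pow_succ', Module.End.mul_apply, ← hone]
      exact hlow fun _ => 1
    rw [h0, map_zero, smul_zero, eq_comm, smul_eq_zero] at h
    exact eq_neg_of_add_eq_zero_right (h.resolve_left (by exact_mod_cast n.succ_ne_zero))
  obtain ⟨g, hg⟩ : ∃ g : Module.Dual ℂ V, g w = 1 := by
    obtain ⟨g, hg⟩ : ∃ g : Module.Dual ℂ V, g w ≠ 0 := by
      by_contra! h
      exact hw0 ((Module.forall_dual_apply_eq_zero_iff ℂ w).1 h)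
    exact ⟨(g w)⁻¹ • g, by simp [hg]⟩
  let ψ : MultilinearMap ℂ (fun _ : Fin n => A) ℂ :=
    (g ∘ₗ LinearMap.applyₗ v).compMultilinearMap
      ((MultilinearMap.mkPiAlgebraFin ℂ n (Module.End ℂ V)).compLinearMap fun _ => F)
  have hψ : ∀ P, ψ P = g ((List.ofFn fun j => F (P j)).prod v) := fun P => by simp [ψ]
  have hx : ∀ P : Fin n → A, (List.ofFn fun j => F (P j)).prod v = ψ P • w := by
    intro P
    set x := (List.ofFn fun j => F (P j)).prod v with hxdef
    have hHx : H 1 x = (-(n : ℂ)) • x := by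
      rw [hxdef, cartan_prod_lower hHF hH 1 P]
      simp only [one_mul, Function.update_eq_self, Finset.sum_const, Finset.card_univ,
        Fintype.card_fin, hn]
      module
    -- With E and F exchanged and H negated, x is a highest weight vector of weight n, so F(1)ⁿ
    -- E(1)ⁿ x is a nonzero multiple of x. As E(1)ⁿ x lies in ℂv, x lies in ℂw.
    obtain ⟨a, ha, h⟩ := exists_raise_pow_lower_pow (E := F 1) (F := E 1) (H := -H 1) (m := x)
      (c := n) (fun y => by rw [hEF1]; simp) (fun y => by
        simp only [LinearMap.neg_apply, map_neg, hHE]; abel) (hlow P) (by simp [hHx])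
      rfl le_rfl
    obtain ⟨c, hc⟩ := htop P
    rw [← hxdef] at hc
    rw [hc, map_smul, ← hw] at h
    have hxw : x = (a⁻¹ * c) • w := by
      rw [mul_smul, h, smul_smul, inv_mul_cancel₀ ha, one_smul]
    rw [hψ, ← hxdef, hxw, map_smul, hg, smul_eq_mul, mul_one]
  refine exists_eq_sum_algHom ψ χ ?_ fun Q P => ?_
  · rw [hψ, hone, ← hw, hg]
    exact one_ne_zero
  · have h := congrArg g (cartan_prod_lower hHF hH Q P)
    simp only [map_sub, map_smul, map_sum, ← hψ] at h
    rw [hx P, map_smul, hHw, map_smul, map_neg, map_smul, hg] at h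
    simp only [smul_eq_mul] at h
    linear_combination (-1 / 2 : ℂ) * h

end Loop

end SlTwo

/-! ### Weight spaces and reflections of weights -/

section Weights

open LieAlgebra LieAlgebra.IsKilling

variable {𝔤 : Type*} [LieRing 𝔤] [LieAlgebra ℂ 𝔤] [FiniteDimensional ℂ 𝔤]
  [LieAlgebra.IsSemisimple ℂ 𝔤] {𝔥 : LieSubalgebra ℂ 𝔤} [𝔥.IsCartanSubalgebra]
  {A : Type*} [CommRing A] [Algebra ℂ A]
  {V : Type*} [AddCommGroup V] [Module ℂ V] [LieRingModule (A ⊗[ℂ] 𝔤) V]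
  [LieModule ℂ (A ⊗[ℂ] 𝔤) V]

lemma tmul_lie_tmul_lie (P Q : A) (x y : 𝔤) (w : V) :
    ⁅P ⊗ₜ[ℂ] x, ⁅Q ⊗ₜ[ℂ] y, w⁆⁆ =
      ⁅(P * Q) ⊗ₜ[ℂ] ⁅x, y⁆, w⁆ + ⁅Q ⊗ₜ[ℂ] y, ⁅P ⊗ₜ[ℂ] x, w⁆⁆ := by
  rw [leibniz_lie, LieAlgebra.ExtendScalars.bracket_tmul]

lemma lie_mem_weightSpace {μ χ : Module.Dual ℂ 𝔥} {x : 𝔤} (hx : x ∈ rootSpace 𝔥 χ) (P : A)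
    {w : V} (hw : w ∈ weightSpace 𝔥 A V μ) : ⁅P ⊗ₜ[ℂ] x, w⁆ ∈ weightSpace 𝔥 A V (μ + χ) := by
  intro h
  have h1 : ⁅(h : 𝔤), x⁆ = χ h • x := lie_eq_smul_of_mem_rootSpace hx h
  rw [tmul_lie_tmul_lie, hw h, h1, one_mul, TensorProduct.tmul_smul, smul_lie, lie_smul,
    ← add_smul, LinearMap.add_apply, add_comm]

lemma cartan_lie_mem_weightSpace {μ : Module.Dual ℂ 𝔥} (x : 𝔥) (P : A)
    {w : V} (hw : w ∈ weightSpace 𝔥 A V μ) : ⁅P ⊗ₜ[ℂ] (x : 𝔤), w⁆ ∈ weightSpace 𝔥 A V μ := by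
  have h0 : (x : 𝔤) ∈ rootSpace 𝔥 ((0 : Module.Dual ℂ 𝔥) : 𝔥 → ℂ) := by
    change (x : 𝔤) ∈ rootSpace 𝔥 (0 : 𝔥 → ℂ)
    simp
  simpa using lie_mem_weightSpace h0 P hw

/-- Weight spaces lie in the simultaneous generalized eigenspaces of the commuting operators h ⊗ 1.
-/
lemma iSupIndep_weightSpace : iSupIndep (weightSpace 𝔥 A V) := by
  let f : 𝔥 → Module.End ℂ V := fun h => LieModule.toEnd ℂ (A ⊗[ℂ] 𝔤) V ((1 : A) ⊗ₜ[ℂ] (h : 𝔤))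
  have hcomm : ∀ h k, Commute (f h) (f k) := by
    intro h k
    ext w
    change ⁅(1 : A) ⊗ₜ[ℂ] (h : 𝔤), ⁅(1 : A) ⊗ₜ[ℂ] (k : 𝔤), w⁆⁆ =
      ⁅(1 : A) ⊗ₜ[ℂ] (k : 𝔤), ⁅(1 : A) ⊗ₜ[ℂ] (h : 𝔤), w⁆⁆
    have : ⁅(h : 𝔤), (k : 𝔤)⁆ = 0 := by
      rw [← LieSubalgebra.coe_bracket, LieModule.IsTrivial.trivial]
      rfl
    rw [tmul_lie_tmul_lie, this, TensorProduct.tmul_zero, zero_lie, zero_add]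
  have key := Module.End.independent_iInf_maxGenEigenspace_of_forall_mapsTo f
    fun h k φ => Module.End.mapsTo_maxGenEigenspace_of_comm (hcomm k h) φ
  have key2 := key.comp (f := fun μ : Module.Dual ℂ 𝔥 => (μ : 𝔥 → ℂ)) DFunLike.coe_injective
  refine key2.mono fun μ x hx => ?_
  simp only [Function.comp_apply, Submodule.mem_iInf]
  intro h
  exact Module.End.mem_maxGenEigenspace _ _ _ |>.2 ⟨1, by
    rw [pow_one, LinearMap.sub_apply, sub_eq_zero]; exact hx h⟩

lemma weightSpace_eq_bot_of_iSup_eq_top {ι : Sort*} {f : ι → Module.Dual ℂ 𝔥}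
    (hf : ⨆ j, weightSpace 𝔥 A V (f j) = ⊤) {μ : Module.Dual ℂ 𝔥} (hμ : ∀ j, f j ≠ μ) :
    weightSpace 𝔥 A V μ = ⊥ := by
  have h := iSupIndep_weightSpace (𝔥 := 𝔥) (A := A) (V := V) μ
  refine disjoint_self.1 (h.mono_right (le_top.trans ?_))
  rw [← hf]
  exact iSup_le fun j => le_iSup₂_of_le (f j) (hμ j) le_rfl

lemma root_apply_coroot_self (i : 𝔥.root) :
    (rootSystem 𝔥).root i ((rootSystem 𝔥).coroot i) = 2 :=
  (rootSystem 𝔥).root_coroot_two i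

lemma exists_slTwo (i : 𝔥.root) : ∃ e f : 𝔤,
    e ∈ rootSpace 𝔥 ((rootSystem 𝔥).root i) ∧ f ∈ rootSpace 𝔥 (-(rootSystem 𝔥).root i) ∧
    ⁅e, f⁆ = ((rootSystem 𝔥).coroot i : 𝔤) := by
  have hi : (i : LieModule.Weight ℂ 𝔥 𝔤).IsNonZero := by
    obtain ⟨i, hi⟩ := i
    simpa using hi
  obtain ⟨h, e, f, ht, he, hf⟩ := exists_isSl2Triple_of_weight_isNonZero hi
  exact ⟨e, f, he, hf, ht.lie_e_f.trans (ht.h_eq_coroot hi he hf)⟩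

/-- The operators `x ⊗ P`, for a fixed `x ∈ 𝔤`. -/
def currentEnd (V : Type*) [AddCommGroup V] [Module ℂ V] [LieRingModule (A ⊗[ℂ] 𝔤) V]
    [LieModule ℂ (A ⊗[ℂ] 𝔤) V] (x : 𝔤) : A →ₗ[ℂ] Module.End ℂ V :=
  (LieModule.toEnd ℂ (A ⊗[ℂ] 𝔤) V : (A ⊗[ℂ] 𝔤) →ₗ[ℂ] Module.End ℂ V) ∘ₗ
    (TensorProduct.mk ℂ A 𝔤).flip x

@[simp]
lemma currentEnd_apply (x : 𝔤) (P : A) (w : V) : currentEnd V x P w = ⁅P ⊗ₜ[ℂ] x, w⁆ := rfl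

section Triple

variable {i : 𝔥.root} {e f : 𝔤} (he : e ∈ rootSpace 𝔥 ((rootSystem 𝔥).root i))
  (hf : f ∈ rootSpace 𝔥 (-(rootSystem 𝔥).root i)) (hef : ⁅e, f⁆ = ((rootSystem 𝔥).coroot i : 𝔤))

include he in
lemma coroot_lie_e : ⁅((rootSystem 𝔥).coroot i : 𝔤), e⁆ = (2 : ℂ) • e := by
  have h := lie_eq_smul_of_mem_rootSpace he ((rootSystem 𝔥).coroot i)
  rw [root_apply_coroot_self] at h
  exact h

include hf in
lemma coroot_lie_f : ⁅((rootSystem 𝔥).coroot i : 𝔤), f⁆ = (-2 : ℂ) • f := by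
  have h := lie_eq_smul_of_mem_rootSpace hf ((rootSystem 𝔥).coroot i)
  rw [Pi.neg_apply, root_apply_coroot_self] at h
  exact h

include hef in
lemma currentEnd_e_f (P Q : A) (w : V) : currentEnd V e P (currentEnd V f Q w) =
    currentEnd V f Q (currentEnd V e P w) +
      currentEnd V ((rootSystem 𝔥).coroot i : 𝔤) (P * Q) w := by
  simp only [currentEnd_apply]
  rw [tmul_lie_tmul_lie, hef, add_comm]

include hf in
lemma currentEnd_h_f (P Q : A) (w : V) :
    currentEnd V ((rootSystem 𝔥).coroot i : 𝔤) P (currentEnd V f Q w) =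
      currentEnd V f Q (currentEnd V ((rootSystem 𝔥).coroot i : 𝔤) P w) -
        (2 : ℂ) • currentEnd V f (P * Q) w := by
  simp only [currentEnd_apply]
  rw [tmul_lie_tmul_lie, coroot_lie_f hf, TensorProduct.tmul_smul, smul_lie]
  module

include he in
lemma currentEnd_h_e (P Q : A) (w : V) :
    currentEnd V ((rootSystem 𝔥).coroot i : 𝔤) P (currentEnd V e Q w) =
      currentEnd V e Q (currentEnd V ((rootSystem 𝔥).coroot i : 𝔤) P w) +
        (2 : ℂ) • currentEnd V e (P * Q) w := by
  simp only [currentEnd_apply]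
  rw [tmul_lie_tmul_lie, coroot_lie_e he, TensorProduct.tmul_smul, smul_lie]
  module

lemma currentEnd_comm (x : 𝔤) (P Q : A) (w : V) : currentEnd V x P (currentEnd V x Q w) =
    currentEnd V x Q (currentEnd V x P w) := by
  simp only [currentEnd_apply]
  rw [tmul_lie_tmul_lie, lie_self, TensorProduct.tmul_zero, zero_lie, zero_add]

lemma currentEnd_pow_mem {μ χ : Module.Dual ℂ 𝔥} {x : 𝔤} (hx : x ∈ rootSpace 𝔥 χ) (P : A)
    {w : V} (hw : w ∈ weightSpace 𝔥 A V μ) (m : ℕ) :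
    (currentEnd V x P ^ m) w ∈ weightSpace 𝔥 A V (μ + m • χ) := by
  induction m with
  | zero => simpa using hw
  | succ m ih =>
    rw [pow_succ', Module.End.mul_apply, succ_nsmul, ← add_assoc]
    exact lie_mem_weightSpace hx P ih

/-- The set of weights is stable under a reflection; here for weights with a non-positive value on
the coroot. -/
lemma weightSpace_reflection_ne_bot (hfin : {μ | weightSpace 𝔥 A V μ ≠ ⊥}.Finite) (i : 𝔥.root)
    {μ : Module.Dual ℂ 𝔥} {k : ℕ} (hk : μ ((rootSystem 𝔥).coroot i) = -k)
    (hμ : weightSpace 𝔥 A V μ ≠ ⊥) :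
    weightSpace 𝔥 A V (μ + k • (rootSystem 𝔥).root i) ≠ ⊥ := by
  obtain ⟨e, f, he, hf, hef⟩ := exists_slTwo i
  obtain ⟨x, hx, hx0⟩ := (Submodule.ne_bot_iff _).1 hμ
  set α := (rootSystem 𝔥).root i with hα
  have hf' : f ∈ rootSpace 𝔥 ((-α : Module.Dual ℂ 𝔥) : 𝔥 → ℂ) := hf
  have hα0 : α ≠ 0 := (rootSystem 𝔥).ne_zero i
  have hex : ∃ j, (currentEnd V f (1 : A) ^ j) x = 0 := by
    by_contra! hne
    have hinj : Function.Injective fun j : ℕ => μ + j • (-α) := by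
      intro j k hjk
      simp only [add_right_inj, ← Nat.cast_smul_eq_nsmul ℂ] at hjk
      exact_mod_cast smul_left_injective ℂ (neg_ne_zero.2 hα0) hjk
    refine Set.infinite_range_of_injective hinj (hfin.subset ?_)
    rintro _ ⟨j, rfl⟩
    exact (Submodule.ne_bot_iff _).2 ⟨_, currentEnd_pow_mem hf' 1 hx j, hne j⟩
  classical
  obtain ⟨m, hm⟩ : ∃ m, Nat.find hex = m + 1 := Nat.exists_eq_succ_of_ne_zero fun h => by
    have := Nat.find_spec hex
    rw [h] at this
    exact hx0 (by simpa using this)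
  have hm0 : (currentEnd V f (1 : A) ^ (m + 1)) x = 0 := hm ▸ Nat.find_spec hex
  have hy0 : (currentEnd V f (1 : A) ^ m) x ≠ 0 := Nat.find_min hex (by omega)
  have hy := currentEnd_pow_mem hf' (1 : A) hx m
  set y := (currentEnd V f (1 : A) ^ m) x with hydef
  have hα2 : α ((rootSystem 𝔥).coroot i) = 2 := root_apply_coroot_self i
  -- The last nonzero vector y = fᵐ x is a lowest weight vector of weight -(k + 2m). As k + m ≤ k +
  -- 2m, the vector eᵏ⁺ᵐ y is nonzero, and its weight is μ + kα.
  obtain ⟨a, ha, h⟩ := exists_raise_pow_lower_pow (E := currentEnd V f (1 : A))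
    (F := currentEnd V e (1 : A)) (H := -currentEnd V ((rootSystem 𝔥).coroot i : 𝔤) (1 : A))
    (m := y) (c := (k + 2 * m : ℕ)) (n := k + 2 * m) (k := k + m)
    (fun w => by rw [currentEnd_e_f hef 1 1]; simp)
    (fun w => by
      rw [LinearMap.neg_apply, currentEnd_h_e he 1 1, mul_one, LinearMap.neg_apply, map_neg]
      abel)
    (by rw [hydef, ← Module.End.mul_apply, ← pow_succ', hm0])
    (by
      rw [LinearMap.neg_apply, currentEnd_apply, hy]
      simp only [LinearMap.add_apply, LinearMap.smul_apply, LinearMap.neg_apply, hk, hα2]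
      push_cast
      module) rfl (by omega)
  have hz := currentEnd_pow_mem he (1 : A) hy (k + m)
  have heq : μ + m • -α + (k + m) • α = μ + k • α := by module
  rw [heq] at hz
  refine (Submodule.ne_bot_iff _).2 ⟨_, hz, fun h0 => ?_⟩
  rw [h0, map_zero, eq_comm, smul_eq_zero] at h
  exact h.elim ha hy0

end Triple

end Weights

/-! ### Highest weight modules and the cone of simple roots -/

section HighestWeight

open LieAlgebra LieAlgebra.IsKilling

variable {𝔤 : Type*} [LieRing 𝔤] [LieAlgebra ℂ 𝔤] [FiniteDimensional ℂ 𝔤]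
  [LieAlgebra.IsSemisimple ℂ 𝔤] {𝔥 : LieSubalgebra ℂ 𝔤} [𝔥.IsCartanSubalgebra]
  (b : (LieAlgebra.IsKilling.rootSystem 𝔥).Base)

/-- The cone `Q₊` of sums of simple roots. -/
def rootCone : AddSubmonoid (Module.Dual ℂ 𝔥) :=
  AddSubmonoid.closure ((rootSystem 𝔥).root '' b.support)

/-- The linear functional taking the value `1` on all simple roots. -/
def heightForm : Module.Dual ℂ 𝔥 →ₗ[ℂ] ℂ := b.toWeightBasis.constr ℂ fun _ => (1 : ℂ)

variable {b}

lemma root_mem_rootCone {i : 𝔥.root} (hi : i ∈ b.support) :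
    (rootSystem 𝔥).root i ∈ rootCone b :=
  AddSubmonoid.subset_closure ⟨i, hi, rfl⟩

lemma heightForm_root {i : 𝔥.root} (hi : i ∈ b.support) :
    heightForm b ((rootSystem 𝔥).root i) = 1 := by
  have := b.toWeightBasis.constr_basis ℂ (fun _ => (1 : ℂ)) ⟨i, hi⟩
  rwa [b.toWeightBasis_apply] at this

lemma exists_nat_eq_heightForm {β : Module.Dual ℂ 𝔥} (hβ : β ∈ rootCone b) :
    ∃ k : ℕ, heightForm b β = k := by
  induction hβ using AddSubmonoid.closure_induction with
  | mem x hx =>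
    obtain ⟨i, hi, rfl⟩ := hx
    exact ⟨1, by rw [heightForm_root hi, Nat.cast_one]⟩
  | zero => exact ⟨0, by simp⟩
  | add x y _ _ hx hy =>
    obtain ⟨k, hk⟩ := hx
    obtain ⟨l, hl⟩ := hy
    exact ⟨k + l, by rw [map_add, hk, hl, Nat.cast_add]⟩

/-- A root in the cone has a natural number as height, hence is positive; so a root that is not
positive has its negative in the cone. -/
lemma neg_root_mem_rootCone {i : 𝔥.root} (hi : ¬ b.IsPos i) :
    -(rootSystem 𝔥).root i ∈ rootCone b := by
  refine (b.root_mem_or_neg_mem i).resolve_left fun h => hi ?_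
  obtain ⟨k, hk⟩ := exists_nat_eq_heightForm (b := b) h
  obtain ⟨f, -, -, hf⟩ := b.exists_root_eq_sum_int i
  have hh : heightForm b ((rootSystem 𝔥).root i) = (b.height i : ℂ) := by
    rw [RootPairing.Base.height_eq_sum hf, hf, map_sum, Int.cast_sum]
    refine Finset.sum_congr rfl fun j hj => ?_
    rw [map_zsmul, heightForm_root hj, zsmul_one]
  rw [hh] at hk
  rw [RootPairing.Base.isPos_iff']
  have : b.height i = k := by exact_mod_cast hk
  omega

/-- A subspace of `𝔤` containing `𝔫₊`, `𝔥` and the negative root spaces is everything. -/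
lemma eq_top_of_nPlus_le {S : Submodule ℂ 𝔤} (hpos : nPlus b ≤ S)
    (hlow : ∀ χ : Module.Dual ℂ 𝔥, -χ ∈ rootCone b → ∀ x ∈ rootSpace 𝔥 χ, x ∈ S) : S = ⊤ := by
  have h := LieModule.iSup_genWeightSpace_eq_top' ℂ 𝔥 𝔤
  rw [← LieSubmodule.toSubmodule_inj, LieSubmodule.iSup_toSubmodule,
    LieSubmodule.top_toSubmodule] at h
  rw [eq_top_iff, ← h]
  refine iSup_le fun χ => ?_
  by_cases hχ : χ.IsZero
  · intro x hx
    refine hlow 0 (by simp) x ?_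
    have : (χ : 𝔥 → ℂ) = ((0 : Module.Dual ℂ 𝔥) : 𝔥 → ℂ) := hχ
    rw [← this]
    exact hx
  · have hmem : χ ∈ 𝔥.root := by simpa using hχ
    by_cases hp : b.IsPos ⟨χ, hmem⟩
    · refine le_trans ?_ hpos
      exact le_iSup (fun α : {α : 𝔥.root // b.IsPos α} =>
        (rootSpace 𝔥 (α.1.1 : 𝔥 → ℂ)).toSubmodule) ⟨⟨χ, hmem⟩, hp⟩
    · exact fun x hx => hlow _ (neg_root_mem_rootCone hp) x hx

variable {V : Type*} [AddCommGroup V] [Module ℂ V]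
  (A : Type*) [CommRing A] [Algebra ℂ A] [LieRingModule (A ⊗[ℂ] 𝔤) V]
  [LieModule ℂ (A ⊗[ℂ] 𝔤) V]

variable (b) in
/-- `V` is generated by `v`, a vector of weight `lam` annihilated by `𝔫₊ ⊗ A`. -/
structure IsHighestWeight (lam : Module.Dual ℂ 𝔥) (v : V) : Prop where
  mem_weightSpace : v ∈ weightSpace 𝔥 A V lam
  nPlus_lie : ∀ x ∈ nPlus b, ∀ P : A, ⁅P ⊗ₜ[ℂ] x, v⁆ = 0
  eq_top : ∀ T : Submodule ℂ V, v ∈ T →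
    (∀ (P : A) (x : 𝔤), ∀ t ∈ T, ⁅P ⊗ₜ[ℂ] x, t⁆ ∈ T) → T = ⊤

variable {A}
variable {lam : Module.Dual ℂ 𝔥} {v : V}

namespace IsHighestWeight

/-- The module is already generated from `v` by 𝔥 ⊗ A and the lowering operators, which only
subtract elements of the cone from weights. This replaces the triangular decomposition of the
enveloping algebra. -/
lemma iSup_weightSpace_eq_top (hv : IsHighestWeight b A lam v) :
    ⨆ β : rootCone b, weightSpace 𝔥 A V (lam - β) = ⊤ := by
  let C : Set (Submodule ℂ V) := {T | v ∈ T ∧ ∀ χ : Module.Dual ℂ 𝔥, -χ ∈ rootCone b →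
    ∀ x ∈ rootSpace 𝔥 χ, ∀ (P : A), ∀ t ∈ T, ⁅P ⊗ₜ[ℂ] x, t⁆ ∈ T}
  have hC : sInf C ∈ C := ⟨Submodule.mem_sInf.2 fun T hT => hT.1, fun χ hχ x hx P t ht =>
    Submodule.mem_sInf.2 fun T hT => hT.2 χ hχ x hx P t (Submodule.mem_sInf.1 ht T hT)⟩
  -- `sInf C` is the span of `v` under lowering and Cartan operators. T' collects its vectors that
  -- all of 𝔤 ⊗ A keeps inside it; the commutator formula shows T' ∈ C, so `sInf C` is a 𝔤 ⊗
  -- A-submodule.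
  let T' : Submodule ℂ V := sInf C ⊓ ⨅ (P : A) (x : 𝔤), (sInf C).comap (currentEnd V x P)
  have hT' : ∀ t, t ∈ T' ↔ t ∈ sInf C ∧ ∀ (P : A) (x : 𝔤), ⁅P ⊗ₜ[ℂ] x, t⁆ ∈ sInf C := by
    intro t
    simp [T', Submodule.mem_iInf]
  have hle : sInf C ≤ T' := by
    refine sInf_le ⟨(hT' v).2 ⟨hC.1, fun P x => ?_⟩, fun χ hχ x hx P t ht =>
      (hT' _).2 ⟨hC.2 χ hχ x hx P t ((hT' t).1 ht).1, fun Q y => ?_⟩⟩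
    · let φ : 𝔤 →ₗ[ℂ] V := LinearMap.applyₗ v ∘ₗ
        (LieModule.toEnd ℂ (A ⊗[ℂ] 𝔤) V : (A ⊗[ℂ] 𝔤) →ₗ[ℂ] Module.End ℂ V) ∘ₗ
          TensorProduct.mk ℂ A 𝔤 P
      have htop : (sInf C).comap φ = ⊤ := by
        refine eq_top_of_nPlus_le (b := b) (fun y hy => ?_) fun χ hχ y hy => ?_
        · change ⁅P ⊗ₜ[ℂ] y, v⁆ ∈ sInf C
          rw [hv.nPlus_lie y hy P]
          exact Submodule.zero_mem _
        · exact hC.2 χ hχ y hy P v hC.1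
      exact (htop ▸ Submodule.mem_top : x ∈ (sInf C).comap φ)
    · rw [tmul_lie_tmul_lie]
      exact Submodule.add_mem _ (((hT' t).1 ht).2 _ _)
        (hC.2 χ hχ x hx P _ (((hT' t).1 ht).2 _ _))
  have htop := hv.eq_top (sInf C) hC.1 fun P x t ht => ((hT' t).1 (hle ht)).2 P x
  rw [eq_top_iff, ← htop]
  refine sInf_le ⟨?_, fun χ hχ x hx P t ht => ?_⟩
  · exact Submodule.mem_iSup_of_mem (0 : rootCone b) (by simpa using hv.mem_weightSpace)
  · induction ht using Submodule.iSup_induction' with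
    | mem β t ht =>
      refine Submodule.mem_iSup_of_mem (⟨β - χ, ?_⟩ : rootCone b) ?_
      · rw [sub_eq_add_neg]
        exact (rootCone b).add_mem β.2 hχ
      · have := lie_mem_weightSpace hx P ht
        rwa [sub_add] at this
    | zero => rw [lie_zero]; exact Submodule.zero_mem _
    | add x y _ _ hx hy => rw [lie_add]; exact Submodule.add_mem _ hx hy

lemma sub_mem_rootCone (hv : IsHighestWeight b A lam v) {μ : Module.Dual ℂ 𝔥}
    (hμ : weightSpace 𝔥 A V μ ≠ ⊥) : lam - μ ∈ rootCone b := by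
  by_contra h
  refine hμ (weightSpace_eq_bot_of_iSup_eq_top hv.iSup_weightSpace_eq_top fun β hβ => h ?_)
  rw [← hβ, sub_sub_cancel]
  exact β.2

lemma weightSpace_add_root_eq_bot (hv : IsHighestWeight b A lam v) {i : 𝔥.root}
    (hi : i ∈ b.support) {k : ℕ} (hk : 0 < k) :
    weightSpace 𝔥 A V (lam + k • (rootSystem 𝔥).root i) = ⊥ := by
  by_contra h
  obtain ⟨l, hl⟩ := exists_nat_eq_heightForm (hv.sub_mem_rootCone h)
  rw [sub_add_cancel_left, map_neg, map_nsmul, heightForm_root hi, nsmul_one] at hl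
  have : (k : ℂ) + l = 0 := by rw [← hl]; ring
  have : k + l = 0 := by exact_mod_cast this
  omega

end IsHighestWeight

end HighestWeight

/-! ### The root form, bounds on weights and integrability -/

section RootForm

open LieAlgebra LieAlgebra.IsKilling
open scoped ComplexOrder

variable {𝔤 : Type*} [LieRing 𝔤] [LieAlgebra ℂ 𝔤] [FiniteDimensional ℂ 𝔤]
  [LieAlgebra.IsSemisimple ℂ 𝔤] {𝔥 : LieSubalgebra ℂ 𝔤} [𝔥.IsCartanSubalgebra]
  {b : (LieAlgebra.IsKilling.rootSystem 𝔥).Base}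

lemma sub_mem_weightLattice {μ ν : Module.Dual ℂ 𝔥} (hμ : μ ∈ weightLattice b)
    (hν : ν ∈ weightLattice b) : μ - ν ∈ weightLattice b := by
  intro i
  obtain ⟨k, hk⟩ := hμ i
  obtain ⟨l, hl⟩ := hν i
  exact ⟨k - l, by rw [LinearMap.sub_apply, hk, hl, Int.cast_sub]⟩

lemma mem_weightLattice_of_mem_rootCone {β : Module.Dual ℂ 𝔥} (hβ : β ∈ rootCone b) :
    β ∈ weightLattice b := by
  intro i
  induction hβ using AddSubmonoid.closure_induction with
  | mem x hx =>
    obtain ⟨j, -, rfl⟩ := hx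
    obtain ⟨z, hz⟩ := RootPairing.exists_value (P := rootSystem 𝔥) (S := ℤ) j i
    exact ⟨z, hz.symm⟩
  | zero => exact ⟨0, by simp⟩
  | add x y _ _ hx hy =>
    obtain ⟨k, hk⟩ := hx
    obtain ⟨l, hl⟩ := hy
    exact ⟨k + l, by rw [LinearMap.add_apply, hk, hl, Int.cast_add]⟩

lemma exists_int_eq_apply_coroot {μ : Module.Dual ℂ 𝔥} (hμ : μ ∈ weightLattice b) (i : 𝔥.root) :
    ∃ k : ℤ, μ ((rootSystem 𝔥).coroot i) = k := by
  have key : ∀ h ∈ AddSubmonoid.closure ((rootSystem 𝔥).coroot '' b.support),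
      ∃ k : ℤ, μ h = k := by
    intro h hh
    induction hh using AddSubmonoid.closure_induction with
    | mem x hx =>
      obtain ⟨j, hj, rfl⟩ := hx
      exact hμ ⟨j, hj⟩
    | zero => exact ⟨0, by simp⟩
    | add x y _ _ hx hy =>
      obtain ⟨k, hk⟩ := hx
      obtain ⟨l, hl⟩ := hy
      exact ⟨k + l, by rw [map_add, hk, hl, Int.cast_add]⟩
  rcases b.coroot_mem_or_neg_mem i with h | h
  · exact key _ h
  · obtain ⟨k, hk⟩ := key _ h
    exact ⟨-k, by rw [Int.cast_neg, ← hk, map_neg, neg_neg]⟩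

lemma rootForm_apply (μ ν : Module.Dual ℂ 𝔥) : (rootSystem 𝔥).RootForm μ ν =
    ∑ i, μ ((rootSystem 𝔥).coroot i) * ν ((rootSystem 𝔥).coroot i) :=
  (rootSystem 𝔥).rootForm_apply_apply μ ν

lemma mul_self_apply_coroot_nonneg {μ : Module.Dual ℂ 𝔥} (hμ : μ ∈ weightLattice b) (i : 𝔥.root) :
    0 ≤ μ ((rootSystem 𝔥).coroot i) * μ ((rootSystem 𝔥).coroot i) := by
  obtain ⟨k, hk⟩ := exists_int_eq_apply_coroot hμ i
  rw [hk, ← Int.cast_mul]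
  exact Int.cast_nonneg (mul_self_nonneg k)

lemma rootForm_self_nonneg {μ : Module.Dual ℂ 𝔥} (hμ : μ ∈ weightLattice b) :
    0 ≤ (rootSystem 𝔥).RootForm μ μ := by
  rw [rootForm_apply]
  exact Finset.sum_nonneg fun i _ => mul_self_apply_coroot_nonneg hμ i

/-- For a simple root α one has (α, α) μ(h_α) = 2 (α, μ), so dominance gives the sign on generators
of the cone. -/
lemma rootForm_nonneg_of_dominant {μ β : Module.Dual ℂ 𝔥}
    (hdom : ∀ i ∈ b.support, 0 ≤ μ ((rootSystem 𝔥).coroot i)) (hβ : β ∈ rootCone b) :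
    0 ≤ (rootSystem 𝔥).RootForm μ β := by
  induction hβ using AddSubmonoid.closure_induction with
  | mem x hx =>
    obtain ⟨i, hi, rfl⟩ := hx
    have h := congrArg μ ((rootSystem 𝔥).rootForm_self_smul_coroot i)
    have hpol : μ ((rootSystem 𝔥).Polarization ((rootSystem 𝔥).root i)) =
        (rootSystem 𝔥).RootForm ((rootSystem 𝔥).root i) μ :=
      (rootSystem 𝔥).toLinearMap_apply_apply_Polarization _ _
    rw [map_smul, map_nsmul, hpol, rootForm_apply _ μ, smul_eq_mul] at h
    have h0 := mul_nonneg (rootForm_self_nonneg (b := b)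
      (mem_weightLattice_of_mem_rootCone (root_mem_rootCone hi))) (hdom i hi)
    rw [h, nsmul_eq_mul] at h0
    rw [rootForm_apply]
    simp only [mul_comm (μ _)]
    have h2 := mul_nonneg (Complex.le_def.2 ⟨by norm_num, by norm_num⟩ : (0 : ℂ) ≤ 1 / 2) h0
    rwa [← mul_assoc, Nat.cast_ofNat, one_div, inv_mul_cancel₀ two_ne_zero, one_mul] at h2
  | zero => simp
  | add x y _ _ hx hy => rw [map_add]; exact add_nonneg hx hy

/-- Expand (lam, lam) with lam = μ + β, where β is in the cone: the extra terms 2(μ, β) and (β, β)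
are non-negative. -/
lemma rootForm_le_of_dominant {μ lam : Module.Dual ℂ 𝔥}
    (hdom : ∀ i ∈ b.support, 0 ≤ μ ((rootSystem 𝔥).coroot i)) (hμ : lam - μ ∈ rootCone b) :
    (rootSystem 𝔥).RootForm μ μ ≤ (rootSystem 𝔥).RootForm lam lam := by
  have h1 := rootForm_nonneg_of_dominant hdom hμ
  have h2 := rootForm_self_nonneg (mem_weightLattice_of_mem_rootCone hμ)
  have h3 : (rootSystem 𝔥).RootForm lam lam = (rootSystem 𝔥).RootForm μ μ +
      (2 * (rootSystem 𝔥).RootForm μ (lam - μ) +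
        (rootSystem 𝔥).RootForm (lam - μ) (lam - μ)) := by
    simp only [rootForm_apply, Finset.mul_sum, ← Finset.sum_add_distrib, LinearMap.sub_apply]
    exact Finset.sum_congr rfl fun i _ => by ring
  rw [h3]
  exact le_add_of_nonneg_right (add_nonneg (mul_nonneg (by norm_num) h1) h2)

-- The form is the sum of squares of the values on all coroots. On the lattice these values are
-- integers, so a bound leaves finitely many choices on the simple coroots, which determine the
-- weight.
variable (b) in
lemma finite_rootForm_le (c : ℂ) :
    {μ | μ ∈ weightLattice b ∧ (rootSystem 𝔥).RootForm μ μ ≤ c}.Finite := by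
  let g : Module.Dual ℂ 𝔥 → b.support → ℂ := fun μ i => μ ((rootSystem 𝔥).coroot i)
  have hg : Function.Injective g := by
    intro μ ν h
    refine b.toCoweightBasis.ext fun i => ?_
    rw [b.toCoweightBasis_apply]
    exact congrFun h i
  have hfin : (Set.univ.pi fun _ : b.support =>
      ((fun k : ℤ => (k : ℂ)) '' Set.Icc (-⌈c.re⌉) ⌈c.re⌉)).Finite :=
    Set.Finite.pi fun _ => (Set.finite_Icc _ _).image _
  refine Set.Finite.of_finite_image (hfin.subset ?_) hg.injOn
  rintro _ ⟨μ, ⟨hμ, hle⟩, rfl⟩ i -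
  obtain ⟨k, hk⟩ := hμ i
  refine ⟨k, ?_, hk.symm⟩
  have h1 : μ ((rootSystem 𝔥).coroot i) * μ ((rootSystem 𝔥).coroot i) ≤ c := by
    refine le_trans ?_ hle
    rw [rootForm_apply]
    exact Finset.single_le_sum (f := fun i => μ ((rootSystem 𝔥).coroot i) *
      μ ((rootSystem 𝔥).coroot i)) (fun j _ => mul_self_apply_coroot_nonneg hμ j)
      (Finset.mem_univ i.1)
  change μ ((rootSystem 𝔥).coroot i) = k at hk
  rw [hk, ← Int.cast_mul] at h1
  have h2 : ((k * k : ℤ) : ℝ) ≤ c.re := by simpa using (Complex.le_def.1 h1).1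
  have h3 : k * k ≤ ⌈c.re⌉ := by exact_mod_cast h2.trans (Int.le_ceil _)
  constructor <;> nlinarith

variable {V : Type*} [AddCommGroup V] [Module ℂ V]
  {A : Type*} [CommRing A] [Algebra ℂ A] [LieRingModule (A ⊗[ℂ] 𝔤) V]
  [LieModule ℂ (A ⊗[ℂ] 𝔤) V] {lam : Module.Dual ℂ 𝔥} {v : V}

lemma IsIntegrable.exists_finset (h : IsIntegrable b A V) :
    ∃ D : Finset (Module.Dual ℂ 𝔥), (D : Set (Module.Dual ℂ 𝔥)) ⊆ weightLattice b ∧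
      ∀ μ, weightSpace 𝔥 A V μ ≠ ⊥ → μ ∈ D := by
  obtain ⟨D, hD, -, htop⟩ := h
  refine ⟨D, hD, fun μ hμ => ?_⟩
  by_contra hμD
  refine hμ (weightSpace_eq_bot_of_iSup_eq_top htop fun ν hν => hμD ?_)
  rw [← hν]
  exact ν.2

lemma IsIntegrable.finite (h : IsIntegrable b A V) :
    {μ | weightSpace 𝔥 A V μ ≠ ⊥}.Finite := by
  obtain ⟨D, -, hD⟩ := h.exists_finset
  exact D.finite_toSet.subset hD

lemma IsIntegrable.mem_weightLattice (h : IsIntegrable b A V) {μ : Module.Dual ℂ 𝔥}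
    (hμ : weightSpace 𝔥 A V μ ≠ ⊥) : μ ∈ weightLattice b := by
  obtain ⟨D, hD, hD'⟩ := h.exists_finset
  exact hD (hD' μ hμ)

/-- All weights of an integrable module of highest weight `lam` are at most as long as `lam`. -/
lemma IsHighestWeight.rootForm_le (hv : IsHighestWeight b A lam v) (hint : IsIntegrable b A V)
    {μ : Module.Dual ℂ 𝔥} (hμ : weightSpace 𝔥 A V μ ≠ ⊥) :
    (rootSystem 𝔥).RootForm μ μ ≤ (rootSystem 𝔥).RootForm lam lam := by
  -- Among the weights as long as μ, one of maximal height is dominant: a negative value on a simple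
  -- coroot would let the reflection raise the height without changing the length.
  obtain ⟨ν, ⟨hν, hνμ⟩, hmax⟩ := Set.exists_max_image
    {ν | weightSpace 𝔥 A V ν ≠ ⊥ ∧ (rootSystem 𝔥).RootForm ν ν = (rootSystem 𝔥).RootForm μ μ}
    (fun ν => (heightForm b ν).re) (hint.finite.subset fun ν hν => hν.1) ⟨μ, hμ, rfl⟩
  rw [← hνμ]
  refine rootForm_le_of_dominant (b := b) (fun i hi => ?_) (hv.sub_mem_rootCone hν)
  obtain ⟨k, hk⟩ := exists_int_eq_apply_coroot (hint.mem_weightLattice hν) i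
  rw [hk]
  by_contra hneg
  have hk0 : k < 0 := by
    by_contra hk0
    exact hneg (Int.cast_nonneg (by omega))
  obtain ⟨m, rfl⟩ : ∃ m : ℕ, k = -m := ⟨k.natAbs, by omega⟩
  have hk' : ν ((rootSystem 𝔥).coroot i) = -m := by rw [hk]; push_cast; rfl
  have hrefl : (rootSystem 𝔥).reflection i ν = ν + m • (rootSystem 𝔥).root i := by
    rw [RootPairing.reflection_apply]
    change ν - ν ((rootSystem 𝔥).coroot i) • (rootSystem 𝔥).root i = _
    rw [hk']
    module
  have := hmax (ν + m • (rootSystem 𝔥).root i)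
    ⟨weightSpace_reflection_ne_bot hint.finite i hk' hν, by
      rw [← hνμ, ← hrefl, RootPairing.rootForm_reflection_reflection_apply]⟩
  rw [map_add, map_nsmul, heightForm_root hi, nsmul_one, Complex.add_re, Complex.natCast_re] at this
  have hm : (0 : ℝ) < m := by exact_mod_cast (by omega : 0 < m)
  linarith

/-- The finite set of weights depends only on `lam`, not on the module; some of its members may have
zero weight space. -/
lemma IsHighestWeight.isIntegrable (hv : IsHighestWeight b A lam v) (hlam : lam ∈ weightLattice b)
    (h : ∀ μ, weightSpace 𝔥 A V μ ≠ ⊥ →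
      (rootSystem 𝔥).RootForm μ μ ≤ (rootSystem 𝔥).RootForm lam lam) : IsIntegrable b A V := by
  refine ⟨(finite_rootForm_le b ((rootSystem 𝔥).RootForm lam lam)).toFinset, fun μ hμ => ?_,
    iSupIndep_weightSpace.comp Subtype.val_injective, ?_⟩
  · simp only [Set.Finite.coe_toFinset] at hμ
    exact hμ.1
  · rw [eq_top_iff, ← hv.iSup_weightSpace_eq_top]
    refine iSup_le fun β => ?_
    by_cases hβ : weightSpace 𝔥 A V (lam - β) = ⊥
    · rw [hβ]
      exact bot_le
    · refine le_iSup_of_le (⟨lam - β, ?_⟩ : {μ // μ ∈ Set.Finite.toFinset _}) le_rfl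
      rw [Set.Finite.mem_toFinset]
      exact ⟨sub_mem_weightLattice hlam (mem_weightLattice_of_mem_rootCone β.2), h _ hβ⟩

variable {W : Type*} [AddCommGroup W] [Module ℂ W] [LieRingModule (A ⊗[ℂ] 𝔤) W]
  [LieModule ℂ (A ⊗[ℂ] 𝔤) W]

lemma map_mem_weightSpace (π : V →ₗ⁅ℂ, A ⊗[ℂ] 𝔤⁆ W) {μ : Module.Dual ℂ 𝔥} {x : V}
    (hx : x ∈ weightSpace 𝔥 A V μ) : π x ∈ weightSpace 𝔥 A W μ := fun h => by
  rw [← LieModuleHom.map_lie, hx h, map_smul]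

lemma IsHighestWeight.map (hv : IsHighestWeight b A lam v) {π : V →ₗ⁅ℂ, A ⊗[ℂ] 𝔤⁆ W}
    (hπ : Function.Surjective π) : IsHighestWeight b A lam (π v) where
  mem_weightSpace := map_mem_weightSpace π hv.mem_weightSpace
  nPlus_lie x hx P := by rw [← LieModuleHom.map_lie, hv.nPlus_lie x hx P, map_zero]
  eq_top T hT hstab := by
    have := hv.eq_top (T.comap (π : V →ₗ[ℂ] W)) hT fun P x t ht => by
      change π ⁅P ⊗ₜ[ℂ] x, t⁆ ∈ T
      rw [LieModuleHom.map_lie]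
      exact hstab P x _ ht
    rw [eq_top_iff]
    intro w _
    obtain ⟨t, rfl⟩ := hπ w
    exact (this ▸ Submodule.mem_top : t ∈ T.comap (π : V →ₗ[ℂ] W))

lemma IsHighestWeight.weightSpace_ne_bot_of_surjective (hv : IsHighestWeight b A lam v)
    {π : V →ₗ⁅ℂ, A ⊗[ℂ] 𝔤⁆ W} (hπ : Function.Surjective π) {μ : Module.Dual ℂ 𝔥}
    (hμ : weightSpace 𝔥 A W μ ≠ ⊥) : weightSpace 𝔥 A V μ ≠ ⊥ := by
  intro h
  refine hμ (weightSpace_eq_bot_of_iSup_eq_top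
    (f := fun ν : {ν : Module.Dual ℂ 𝔥 // weightSpace 𝔥 A V ν ≠ ⊥} => ν.1) ?_ ?_)
  · rw [eq_top_iff, ← (LinearMap.range_eq_top (f := (π : V →ₗ[ℂ] W))).2 hπ, ← Submodule.map_top,
      ← hv.iSup_weightSpace_eq_top, Submodule.map_iSup]
    refine iSup_le fun β => ?_
    by_cases hβ : weightSpace 𝔥 A V (lam - β) = ⊥
    · rw [hβ, Submodule.map_bot]
      exact bot_le
    · refine le_iSup_of_le ⟨lam - β, hβ⟩ ?_
      rintro _ ⟨x, hx, rfl⟩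
      exact map_mem_weightSpace π hx
  · rintro ⟨ν, hν⟩ rfl
    exact hν h

end RootForm

/-! ### Points attached to a simple coroot -/

section Points

open LieAlgebra LieAlgebra.IsKilling

variable {𝔤 : Type*} [LieRing 𝔤] [LieAlgebra ℂ 𝔤] [FiniteDimensional ℂ 𝔤]
  [LieAlgebra.IsSemisimple ℂ 𝔤] {𝔥 : LieSubalgebra ℂ 𝔤} [𝔥.IsCartanSubalgebra]
  {b : (LieAlgebra.IsKilling.rootSystem 𝔥).Base}
  {V : Type*} [AddCommGroup V] [Module ℂ V]
  {A : Type*} [CommRing A] [Algebra ℂ A] [LieRingModule (A ⊗[ℂ] 𝔤) V]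
  [LieModule ℂ (A ⊗[ℂ] 𝔤) V] {lam : Module.Dual ℂ 𝔥} {v : V}

lemma prod_currentEnd_mem {μ χ : Module.Dual ℂ 𝔥} {x : 𝔤} (hx : x ∈ rootSpace 𝔥 χ)
    {w : V} (hw : w ∈ weightSpace 𝔥 A V μ) {n : ℕ} (P : Fin n → A) :
    (List.ofFn fun j => currentEnd V x (P j)).prod w ∈ weightSpace 𝔥 A V (μ + n • χ) := by
  induction n with
  | zero => simpa using hw
  | succ n ih =>
    rw [List.ofFn_succ, List.prod_cons, Module.End.mul_apply, succ_nsmul, ← add_assoc]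
    exact lie_mem_weightSpace hx _ (ih _)

/-- In an integrable highest weight module the value of the highest weight on a simple coroot is a
non-negative integer. -/
lemma IsHighestWeight.exists_nat_eq (hv : IsHighestWeight b A lam v) (hint : IsIntegrable b A V)
    (hv0 : v ≠ 0) {i : 𝔥.root} (hi : i ∈ b.support) :
    ∃ n : ℕ, lam ((rootSystem 𝔥).coroot i) = n := by
  have hlam : weightSpace 𝔥 A V lam ≠ ⊥ := (Submodule.ne_bot_iff _).2 ⟨v, hv.mem_weightSpace, hv0⟩
  obtain ⟨k, hk⟩ := exists_int_eq_apply_coroot (hint.mem_weightLattice hlam) i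
  rcases le_or_gt 0 k with h | h
  · obtain ⟨n, rfl⟩ := Int.eq_ofNat_of_zero_le h
    exact ⟨n, by rw [hk, Int.cast_natCast]⟩
  · obtain ⟨m, rfl⟩ : ∃ m : ℕ, k = -m := ⟨k.natAbs, by omega⟩
    refine absurd (hv.weightSpace_add_root_eq_bot hi (by omega : 0 < m))
      (weightSpace_reflection_ne_bot hint.finite i ?_ hlam)
    rw [hk, Int.cast_neg, Int.cast_natCast]

lemma IsHighestWeight.exists_points (hv : IsHighestWeight b A lam v) (hint : IsIntegrable b A V)
    (hv0 : v ≠ 0) (hone : Module.finrank ℂ (weightSpace 𝔥 A V lam) = 1) (i : b.support) :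
    ∃ s : Multiset (A →ₐ[ℂ] ℂ), (s.card : ℂ) = lam (simpleCoroot b i) ∧
      ∀ P : A, ⁅P ⊗ₜ[ℂ] (simpleCoroot b i : 𝔤), v⁆ = (s.map fun z => z P).sum • v := by
  obtain ⟨i, hi⟩ := i
  change ∃ s : Multiset (A →ₐ[ℂ] ℂ), (s.card : ℂ) = lam ((rootSystem 𝔥).coroot i) ∧
    ∀ P : A, ⁅P ⊗ₜ[ℂ] ((rootSystem 𝔥).coroot i : 𝔤), v⁆ = (s.map fun z => z P).sum • v
  have hline : ∀ w ∈ weightSpace 𝔥 A V lam, ∃ c : ℂ, w = c • v := by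
    intro w hw
    obtain ⟨c, hc⟩ := (finrank_eq_one_iff_of_nonzero'
      (⟨v, hv.mem_weightSpace⟩ : weightSpace 𝔥 A V lam)
      (fun h => hv0 (congrArg Subtype.val h))).1 hone ⟨w, hw⟩
    exact ⟨c, (congrArg Subtype.val hc).symm⟩
  obtain ⟨n, hn⟩ := hv.exists_nat_eq hint hv0 hi
  obtain ⟨e, f, he, hf, hef⟩ := exists_slTwo i
  have hf' : f ∈ rootSpace 𝔥 ((-(rootSystem 𝔥).root i : Module.Dual ℂ 𝔥) : 𝔥 → ℂ) := hf
  have hepos : e ∈ nPlus b := by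
    have := le_iSup (fun α : {α : 𝔥.root // b.IsPos α} =>
      (rootSpace 𝔥 (α.1.1 : 𝔥 → ℂ)).toSubmodule) ⟨i, RootPairing.Base.isPos_of_mem_support hi⟩
    exact this he
  choose χ hχ using fun P : A =>
    hline _ (cartan_lie_mem_weightSpace ((rootSystem 𝔥).coroot i) P hv.mem_weightSpace)
  have hχ1 : χ 1 = n := by
    have h := hχ 1
    rw [hv.mem_weightSpace, hn] at h
    exact (smul_left_injective ℂ hv0 h).symm
  obtain ⟨z, hz⟩ := exists_points_of_slTwo (E := currentEnd V e)
    (F := currentEnd V f) (H := currentEnd V ((rootSystem 𝔥).coroot i : 𝔤)) (v := v) (χ := χ)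
    (currentEnd_e_f hef) (currentEnd_h_f hf)
    (fun w => by rw [currentEnd_h_e he 1 1, mul_one]) (currentEnd_comm f)
    (hv.nPlus_lie e hepos) hχ hv0 hχ1
    (fun P => by
      have h1 := lie_mem_weightSpace hf' (1 : A) (prod_currentEnd_mem hf' hv.mem_weightSpace P)
      by_contra h0
      -- The weight lam - (n + 1)α takes the value n - 2(n + 1) = -(n + 2) on the coroot; its
      -- reflection lam + α is not a weight.
      have h2 := weightSpace_reflection_ne_bot hint.finite i (k := n + 2) (by
        simp only [LinearMap.add_apply, LinearMap.smul_apply, LinearMap.neg_apply, hn,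
          root_apply_coroot_self]
        push_cast
        simp only [nsmul_eq_mul]
        ring) ((Submodule.ne_bot_iff _).2 ⟨_, h1, h0⟩)
      refine h2 ?_
      rw [← hv.weightSpace_add_root_eq_bot hi one_pos]
      congr 1
      module)
    (fun P => by
      refine hline _ ?_
      have := currentEnd_pow_mem he (1 : A) (prod_currentEnd_mem hf' hv.mem_weightSpace P) n
      rwa [add_assoc, smul_neg, neg_add_cancel, add_zero] at this)
  refine ⟨Finset.univ.val.map z, by rw [hn]; simp, fun P => ?_⟩
  rw [hχ P, hz P, Multiset.map_map]
  rfl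

end Points

/-! ### Cyclic modules over the enveloping algebra -/

section Cyclic

variable {𝔤 : Type*} [LieRing 𝔤] [LieAlgebra ℂ 𝔤] {A : Type*} [CommRing A] [Algebra ℂ A]

/-- A subalgebra of `U(𝔤 ⊗ A)` containing `𝔤 ⊗ A` is everything. -/
lemma subalgebra_currentEnv_eq_top (S : Subalgebra ℂ (CurrentEnv 𝔤 A))
    (h : ∀ x, UniversalEnvelopingAlgebra.ι ℂ x ∈ S) : S = ⊤ := by
  let _ : LieRing (CurrentEnv 𝔤 A) := LieRing.ofAssociativeRing
  let _ : LieRing S := LieRing.ofAssociativeRing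
  let f : A ⊗[ℂ] 𝔤 →ₗ⁅ℂ⁆ S :=
    { toFun := fun x => ⟨UniversalEnvelopingAlgebra.ι ℂ x, h x⟩
      map_add' := fun x y => Subtype.ext (map_add _ x y)
      map_smul' := fun c x => Subtype.ext (map_smul _ c x)
      map_lie' := fun {x y} => Subtype.ext (LieHom.map_lie _ x y) }
  have hid : S.val.comp (UniversalEnvelopingAlgebra.lift ℂ f) =
      AlgHom.id ℂ (CurrentEnv 𝔤 A) := by
    refine (UniversalEnvelopingAlgebra.lift ℂ).symm.injective (LieHom.ext fun x => ?_)
    change ((UniversalEnvelopingAlgebra.lift ℂ f (UniversalEnvelopingAlgebra.ι ℂ x) : S) :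
      CurrentEnv 𝔤 A) = UniversalEnvelopingAlgebra.ι ℂ x
    rw [UniversalEnvelopingAlgebra.lift_ι_apply]
    rfl
  rw [eq_top_iff]
  intro u _
  have := DFunLike.congr_fun hid u
  rw [AlgHom.id_apply] at this
  rw [← this]
  exact Subtype.property _

variable {W : Type*} [AddCommGroup W] [Module ℂ W] [LieRingModule (A ⊗[ℂ] 𝔤) W]
  [LieModule ℂ (A ⊗[ℂ] 𝔤) W]

variable (𝔤 A W) in
/-- The action of `U(𝔤 ⊗ A)` on a `𝔤 ⊗ A`-module. -/
def envAction : CurrentEnv 𝔤 A →ₐ[ℂ] Module.End ℂ W :=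
  UniversalEnvelopingAlgebra.lift ℂ (LieModule.toEnd ℂ (A ⊗[ℂ] 𝔤) W)

lemma envAction_ι (x : A ⊗[ℂ] 𝔤) (w : W) :
    envAction 𝔤 A W (UniversalEnvelopingAlgebra.ι ℂ x) w = ⁅x, w⁆ := by
  rw [envAction, UniversalEnvelopingAlgebra.lift_ι_apply]
  rfl

lemma envAction_cur (x : 𝔤) (P : A) (w : W) : envAction 𝔤 A W (cur x P) w = ⁅P ⊗ₜ[ℂ] x, w⁆ :=
  envAction_ι _ w

/-- The annihilator of a vector, as a left ideal of `U(𝔤 ⊗ A)`. -/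
def vectorAnnihilator (w : W) : Submodule (CurrentEnv 𝔤 A) (CurrentEnv 𝔤 A) where
  carrier := {u | envAction 𝔤 A W u w = 0}
  add_mem' {u u'} hu hu' := by
    change envAction 𝔤 A W (u + u') w = 0
    rw [map_add, LinearMap.add_apply, hu, hu', add_zero]
  zero_mem' := by simp
  smul_mem' c u hu := by
    change envAction 𝔤 A W (c * u) w = 0
    rw [map_mul, Module.End.mul_apply, hu, map_zero]

lemma mem_vectorAnnihilator {w : W} {u : CurrentEnv 𝔤 A} :
    u ∈ vectorAnnihilator w ↔ envAction 𝔤 A W u w = 0 := Iff.rfl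

namespace CyclicModule

/-- The generator of a cyclic module. -/
def gen (N : Submodule (CurrentEnv 𝔤 A) (CurrentEnv 𝔤 A)) : CyclicModule N :=
  Submodule.Quotient.mk (1 : CurrentEnv 𝔤 A)

variable {N N' : Submodule (CurrentEnv 𝔤 A) (CurrentEnv 𝔤 A)}

lemma lie_def (x : A ⊗[ℂ] 𝔤) (m : CyclicModule N) :
    ⁅x, m⁆ = UniversalEnvelopingAlgebra.ι ℂ x • m := rfl

lemma smul_gen (u : CurrentEnv 𝔤 A) :
    u • gen N = (Submodule.Quotient.mk u : CurrentEnv 𝔤 A ⧸ N) := by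
  change (Submodule.Quotient.mk (u * 1) : CurrentEnv 𝔤 A ⧸ N) = _
  rw [mul_one]

lemma smul_gen_eq_zero_iff {u : CurrentEnv 𝔤 A} : u • gen N = 0 ↔ u ∈ N := by
  rw [smul_gen]
  exact Submodule.Quotient.mk_eq_zero N

lemma exists_smul_gen (m : CyclicModule N) : ∃ u : CurrentEnv 𝔤 A, u • gen N = m := by
  obtain ⟨u, rfl⟩ := Submodule.Quotient.mk_surjective N m
  exact ⟨u, smul_gen u⟩

lemma envAction_eq_smul (u : CurrentEnv 𝔤 A) (m : CyclicModule N) :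
    envAction 𝔤 A (CyclicModule N) u m = u • m := by
  have h := subalgebra_currentEnv_eq_top
    (AlgHom.equalizer (envAction 𝔤 A (CyclicModule N)) (Algebra.lsmul ℂ ℂ (CyclicModule N)))
    fun x => by
      refine LinearMap.ext fun m => ?_
      rw [envAction_ι]
      rfl
  exact DFunLike.congr_fun (h ▸ Algebra.mem_top : u ∈ AlgHom.equalizer _ _) m

lemma eq_top_of_gen_mem (T : Submodule ℂ (CyclicModule N)) (h1 : gen N ∈ T)
    (h : ∀ (P : A) (x : 𝔤), ∀ t ∈ T, ⁅P ⊗ₜ[ℂ] x, t⁆ ∈ T) : T = ⊤ := by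
  let S : Subalgebra ℂ (CurrentEnv 𝔤 A) :=
    { carrier := {u | ∀ t ∈ T, u • t ∈ T}
      mul_mem' := fun {u u'} hu hu' t ht => by
        rw [mul_smul]
        exact hu _ (hu' t ht)
      add_mem' := fun {u u'} hu hu' t ht => by
        rw [add_smul]
        exact T.add_mem (hu t ht) (hu' t ht)
      algebraMap_mem' := fun c t ht => by
        rw [algebraMap_smul]
        exact T.smul_mem c ht }
  have hS : S = ⊤ := subalgebra_currentEnv_eq_top S fun y t ht => by
    rw [← lie_def]
    induction y using TensorProduct.induction_on with
    | zero => rw [zero_lie]; exact T.zero_mem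
    | tmul P x => exact h P x t ht
    | add y z hy hz => rw [add_lie]; exact T.add_mem hy hz
  rw [eq_top_iff]
  intro m _
  obtain ⟨u, rfl⟩ := exists_smul_gen m
  exact (hS ▸ Algebra.mem_top : u ∈ S) _ h1

/-- The homomorphism sending the generator to a vector annihilated by the defining left ideal. -/
def lift (w : W) (h : N ≤ vectorAnnihilator w) : CyclicModule N →ₗ⁅ℂ, A ⊗[ℂ] 𝔤⁆ W where
  toLinearMap := (N.restrictScalars ℂ).liftQ
    (LinearMap.applyₗ w ∘ₗ (envAction 𝔤 A W).toLinearMap) fun _ hu => h hu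
  map_lie' {x m} := by
    obtain ⟨u, rfl⟩ := Submodule.Quotient.mk_surjective N m
    change envAction 𝔤 A W (UniversalEnvelopingAlgebra.ι ℂ x * u) w = ⁅x, envAction 𝔤 A W u w⁆
    rw [map_mul, Module.End.mul_apply, envAction_ι]

lemma lift_smul_gen (w : W) (h : N ≤ vectorAnnihilator w) (u : CurrentEnv 𝔤 A) :
    lift w h (u • gen N) = envAction 𝔤 A W u w := by
  rw [smul_gen]
  rfl

lemma lift_gen (w : W) (h : N ≤ vectorAnnihilator w) : lift w h (gen N) = w := by
  have := lift_smul_gen w h 1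
  rwa [one_smul, map_one, Module.End.one_apply] at this

/-- A homomorphism of 𝔤 ⊗ A-modules is linear over the enveloping algebra: the elements commuting
with it form a subalgebra containing 𝔤 ⊗ A. -/
lemma le_vectorAnnihilator_map_gen (π : CyclicModule N →ₗ⁅ℂ, A ⊗[ℂ] 𝔤⁆ W) :
    N ≤ vectorAnnihilator (π (gen N)) := by
  have key : ∀ u : CurrentEnv 𝔤 A, ∀ m, π (u • m) = envAction 𝔤 A W u (π m) := by
    let S : Subalgebra ℂ (CurrentEnv 𝔤 A) :=
      { carrier := {u | ∀ m, π (u • m) = envAction 𝔤 A W u (π m)}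
        mul_mem' := fun {u u'} hu hu' m => by
          rw [mul_smul, hu, hu', map_mul, Module.End.mul_apply]
        add_mem' := fun {u u'} hu hu' m => by
          rw [add_smul, map_add, hu, hu', map_add, LinearMap.add_apply]
        algebraMap_mem' := fun c m => by
          rw [algebraMap_smul, map_smul, AlgHom.commutes, Module.algebraMap_end_apply] }
    have hS : S = ⊤ := subalgebra_currentEnv_eq_top S fun x m => by
      rw [← lie_def, LieModuleHom.map_lie, envAction_ι]
    exact fun u => (hS ▸ Algebra.mem_top : u ∈ S)
  intro u hu
  rw [mem_vectorAnnihilator, ← key, smul_gen_eq_zero_iff.2 hu, map_zero]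

/-- Enlarging the left ideal gives a quotient of the cyclic module. -/
def factor (h : N ≤ N') : CyclicModule N →ₗ⁅ℂ, A ⊗[ℂ] 𝔤⁆ CyclicModule N' :=
  lift (gen N') fun u hu => by
    rw [mem_vectorAnnihilator, envAction_eq_smul, smul_gen_eq_zero_iff]
    exact h hu

lemma factor_smul_gen (h : N ≤ N') (u : CurrentEnv 𝔤 A) :
    factor h (u • gen N) = u • gen N' := by
  rw [factor, lift_smul_gen, envAction_eq_smul]

lemma factor_surjective (h : N ≤ N') : Function.Surjective (factor h) := fun m => by
  obtain ⟨u, rfl⟩ := exists_smul_gen m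
  exact ⟨_, factor_smul_gen h u⟩

end CyclicModule

end Cyclic

/-! ### Integrability of quotients of the global Weyl module -/

section Global

open LieAlgebra LieAlgebra.IsKilling CyclicModule

variable {𝔤 : Type*} [LieRing 𝔤] [LieAlgebra ℂ 𝔤] [FiniteDimensional ℂ 𝔤]
  [LieAlgebra.IsSemisimple ℂ 𝔤] {𝔥 : LieSubalgebra ℂ 𝔤} [𝔥.IsCartanSubalgebra]
  {b : (LieAlgebra.IsKilling.rootSystem 𝔥).Base} {A : Type*} [CommRing A] [Algebra ℂ A]
  {lam : Module.Dual ℂ 𝔥}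

lemma isHighestWeight_gen {N : Submodule (CurrentEnv 𝔤 A) (CurrentEnv 𝔤 A)}
    (hN : globalIdeal A b lam ≤ N) : IsHighestWeight b A lam (gen N) where
  mem_weightSpace h := by
    have h1 : cur (h : 𝔤) (1 : A) - algebraMap ℂ (CurrentEnv 𝔤 A) (lam h) ∈ N :=
      hN (Submodule.subset_span (Or.inr ⟨h, rfl⟩))
    rw [← smul_gen_eq_zero_iff, sub_smul, sub_eq_zero, algebraMap_smul] at h1
    exact h1
  nPlus_lie x hx P := by
    have h1 : cur x P ∈ N := hN (Submodule.subset_span (Or.inl ⟨x, hx, P, rfl⟩))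
    exact smul_gen_eq_zero_iff.2 h1
  eq_top := eq_top_of_gen_mem

lemma le_integrableIdeal (J : Submodule (CurrentEnv 𝔤 A) (CurrentEnv 𝔤 A)) :
    J ≤ integrableIdeal b J := le_sInf fun _ hN => hN.1

lemma isHighestWeight_globalWeylModule :
    IsHighestWeight b A lam (gen (integrableIdeal b (globalIdeal A b lam))) :=
  isHighestWeight_gen (le_integrableIdeal _)

/-- A nonzero vector modulo an intersection of left ideals survives modulo one of them. Weights can
thus be bounded before the intersection is known to give an integrable module. -/
lemma exists_integrable_of_weightSpace_ne_bot {μ : Module.Dual ℂ 𝔥}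
    (hμ : weightSpace 𝔥 A (GlobalWeylModule A b lam) μ ≠ ⊥) :
    ∃ N, globalIdeal A b lam ≤ N ∧ IsIntegrable b A (CyclicModule N) ∧
      weightSpace 𝔥 A (CyclicModule N) μ ≠ ⊥ := by
  obtain ⟨x, hx, hx0⟩ := (Submodule.ne_bot_iff _).1 hμ
  obtain ⟨u, rfl⟩ := exists_smul_gen x
  have hu : u ∉ integrableIdeal b (globalIdeal A b lam) := fun h => hx0 (smul_gen_eq_zero_iff.2 h)
  rw [integrableIdeal, Submodule.mem_sInf] at hu
  push Not at hu
  obtain ⟨N, hN, huN⟩ := hu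
  refine ⟨N, hN.1, hN.2, (Submodule.ne_bot_iff _).2 ⟨u • gen N, ?_, fun h0 =>
    huN (smul_gen_eq_zero_iff.1 h0)⟩⟩
  have hle : integrableIdeal b (globalIdeal A b lam) ≤ N := sInf_le hN
  rw [← factor_smul_gen hle]
  exact map_mem_weightSpace _ hx

variable {W : Type*} [AddCommGroup W] [Module ℂ W] [LieRingModule (A ⊗[ℂ] 𝔤) W]
  [LieModule ℂ (A ⊗[ℂ] 𝔤) W]

/-- Every quotient of a nonzero global Weyl module is integrable. -/
lemma isIntegrable_of_surjective
    (hne : gen (integrableIdeal b (globalIdeal A b lam)) ≠ 0)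
    {π : GlobalWeylModule A b lam →ₗ⁅ℂ, A ⊗[ℂ] 𝔤⁆ W} (hπ : Function.Surjective π) :
    IsIntegrable b A W := by
  have hgen := isHighestWeight_globalWeylModule (b := b) (A := A) (lam := lam)
  refine (hgen.map hπ).isIntegrable ?_ fun μ hμ => ?_
  · obtain ⟨N, -, hint, hlam⟩ := exists_integrable_of_weightSpace_ne_bot
      ((Submodule.ne_bot_iff _).2 ⟨_, hgen.mem_weightSpace, hne⟩)
    exact hint.mem_weightLattice hlam
  · obtain ⟨N, hN, hint, hμN⟩ := exists_integrable_of_weightSpace_ne_bot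
      (hgen.weightSpace_ne_bot_of_surjective hπ hμ)
    exact (isHighestWeight_gen hN).rootForm_le hint hμN

end Global

end WeylModules

end

/-! ### The map from the local Weyl module -/

theorem mainTheorem6
    {𝔤 : Type*} [LieRing 𝔤] [LieAlgebra ℂ 𝔤] [FiniteDimensional ℂ 𝔤] [LieAlgebra.IsSemisimple ℂ 𝔤]
    (𝔥 : LieSubalgebra ℂ 𝔤) [𝔥.IsCartanSubalgebra]
    (b : (LieAlgebra.IsKilling.rootSystem 𝔥).Base)
    {A : Type*} [CommRing A] [Algebra ℂ A]
    (lam : Module.Dual ℂ 𝔥)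
    {W : Type*} [AddCommGroup W] [Module ℂ W] [LieRingModule (A ⊗[ℂ] 𝔤) W]
    [LieModule ℂ (A ⊗[ℂ] 𝔤) W]
    (π : WeylModules.GlobalWeylModule A b lam →ₗ⁅ℂ, A ⊗[ℂ] 𝔤⁆ W)
    (hπ : Function.Surjective π)
    (hW : Module.finrank ℂ (WeylModules.weightSpace 𝔥 A W lam) = 1) :
    ∃ (Z : WeylModules.LambdaMultiset A b lam)
      (ρ : WeylModules.LocalWeylModule Z →ₗ⁅ℂ, A ⊗[ℂ] 𝔤⁆ W),
      Function.Surjective ρ := by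
  open WeylModules CyclicModule in
  have hgen := isHighestWeight_globalWeylModule (b := b) (A := A) (lam := lam)
  have hv := hgen.map hπ
  set v := π (gen (integrableIdeal b (globalIdeal A b lam))) with hvdef
  have hv0 : v ≠ 0 := by
    intro h0
    have htop := hv.eq_top ⊥ (by simpa using h0) fun P x t ht => by
      rw [(Submodule.mem_bot ℂ).1 ht, lie_zero]
      exact Submodule.zero_mem _
    have hbot : weightSpace 𝔥 A W lam = ⊥ := eq_bot_iff.2 (htop ▸ le_top)
    rw [hbot, finrank_bot] at hW
    exact zero_ne_one hW
  have hne : gen (integrableIdeal b (globalIdeal A b lam)) ≠ 0 := fun h => hv0 (by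
    rw [hvdef, h, map_zero])
  choose s hs hsv using hv.exists_points (isIntegrable_of_surjective hne hπ) hv0 hW
  let Z : LambdaMultiset A b lam := ⟨s, hs⟩
  have hle : integrableIdeal b (localIdeal Z) ≤ vectorAnnihilator v := by
    -- The annihilator of `v` is one of the ideals intersected: its cyclic module is a quotient of
    -- the global Weyl module, hence integrable, and it contains the local relations.
    refine sInf_le ⟨Submodule.span_le.2 ?_, isIntegrable_of_surjective hne
      (factor_surjective (le_vectorAnnihilator_map_gen π))⟩
    rintro _ (⟨x, hx, P, rfl⟩ | ⟨i, P, rfl⟩)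
    · exact (envAction_cur x P v).trans (hv.nPlus_lie x hx P)
    · rw [SetLike.mem_coe, mem_vectorAnnihilator, map_sub, LinearMap.sub_apply, envAction_cur,
        AlgHom.commutes, Module.algebraMap_end_apply, hsv, sub_self]
  refine ⟨Z, CyclicModule.lift v hle, ?_⟩
  rw [← LieModuleHom.coe_toLinearMap, ← LinearMap.range_eq_top]
  refine hv.eq_top _ ⟨gen _, lift_gen v hle⟩ ?_
  rintro P x _ ⟨m, rfl⟩
  exact ⟨⁅P ⊗ₜ[ℂ] x, m⁆, LieModuleHom.map_lie _ _ _⟩
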